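/- \textbf{Setting.} Let $A\in\mathbb{R}^{m\times n}$, let $f:\mathbb{R}^m\to\mathbb{R}$ be twice continuously differentiable and bounded below, let $\lambda>0$ and $0<q<1$, and put $\psi(x)=f(Ax)$, $g(x)=\|x\|_q^q=\sum_i|x_i|^q$, $F(x)=\psi(x)+\lambda g(x)$ for $x\in\mathbb{R}^n$. For $S\subseteq\{1,\dots,n\}$ let $x_S$ be the subvector of $x$ and $A_S$ the column submatrix of $A$ indexed by $S$, and let $F_S(u)=f(A_Su)+\lambda\sum_{i\in S}|u_i|^q$ for $u\in\mathbb{R}^{|S|}$. Write $\mathrm{supp}(x)=\{i: x_i\neq0\}$, $|x|_{\min}=\min_{i\in\mathrm{supp}(x)}|x_i|$, $[a]_+=\max\{a,0\}$, $\lambda_{\min}(H)$ for the smallest eigenvalue of a symmetric matrix $H$, and $\mathrm{prox}_{\gamma h}(y)=\arg\min_z\{\frac1{2\gamma}\|z-y\|^2+h(z)\}$ (a set). A point $x$ is an \emph{$L$-type stationary point} if $x\in\mathrm{prox}_{\mu^{-1}(\lambda g)}(x-\mu^{-1}\nabla\psi(x))$ for some $\mu>0$. \textbf{KL property.} Let $\partial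 F$ be the limiting (Mordukhovich) subdifferential. $F$ has the KL property at $\bar x\in\mathrm{dom}\,\partial F$ if there are $\eta\in(0,\infty]$, a neighbourhood $U$ of $\bar x$ and a continuous concave $\varphi:[0,\eta)\to[0,\infty)$ with $\varphi(0)=0$, continuously differentiable on $(0,\eta)$ with $\varphi'>0$ there, such that $\varphi'(F(x)-F(\bar x))\,\mathrm{dist}(0,\partial F(x))\ge1$ for all $x\in U$ with $F(\bar x)<F(x)<F(\bar x)+\eta$. The property has exponent $1/2$ if one can take $\varphi(s)=c\sqrt s$ with some $c>0$. $F$ is a KL function if it has the KL property at every point of $\mathrm{dom}\,\partial F$. \textbf{Algorithm HpgSRN (tolerance $0$).} Fix $\tilde\tau>1$, $\tilde\alpha>0$, $\mu_{\max}>\mu_{\min}>0$, $\sigma\in(0,\frac12]$, $\varrho\in(0,\frac12)$, $\beta\in(0,1)$, $b_1>1$, $b_2>0$ and $x^0\in\mathbb{R}^n$. For $k=0,1,2,\dots$: Step 1. Choose $\mu_k\in[\mu_{\min},\mu_{\max}]$. For $l=0,1,\dots$ pick any $y^l\in\mathrm{prox}_{\mu^{-1}(\lambda g)}(x^k-\mu^{-1}\nabla\psi(x^k))$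 with $\mu=\tilde\tau^l\mu_k$, until $F(y^l)\le F(x^k)-\frac{\tilde\alpha}{2}\|y^l-x^k\|^2$; for this first $l$ set $\bar x^k=y^l$, $\bar\mu_k=\tilde\tau^l\mu_k$. Stop if $\bar x^k=x^k$. If $$\mathrm{sign}(x^k)=\mathrm{sign}(\bar x^k)\quad\text{and}\quad \bar\mu_k+\lambda q(q-1)|x^k|_{\min}^{q-2}\ge\tfrac12\big(\bar\mu_k+\lambda q(q-1)|\bar x^k|_{\min}^{q-2}\big),$$ go to Step 2; otherwise set $x^{k+1}=\bar x^k$. Step 2. Let $S_k=\mathrm{supp}(x^k)$, $u^k=x^k_{S_k}$, $r^k=\nabla F_{S_k}(u^k)$, $\zeta_k=[-\lambda_{\min}(\nabla^2F_{S_k}(u^k))]_+$. Let $d^k\in\mathbb{R}^n$ satisfy $d^k_{S_k^c}=0$ and $\big(\nabla^2F_{S_k}(u^k)+(b_1\zeta_k+b_2\|r^k\|^\sigma)I\big)d^k_{S_k}=-r^k$, let $m_k$ be the smallest integer $j\ge0$ with $F_{S_k}(u^k+\beta^jd^k_{S_k})\le F_{S_k}(u^k)+\varrho\beta^j\langle r^k,d^k_{S_k}\rangle$,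 and set $x^{k+1}=x^k+\beta^{m_k}d^k$. Let $\mathcal K_2$ be the set of the $k$ for which $x^{k+1}$ is produced by Step 2. \textbf{Theorem.} Let $\{x^k\}$ be generated by HpgSRN and suppose that the algorithm does not stop, i.e. $x^k\neq\bar x^k$ for all $k$. Assume that $\nabla^2f$ is locally Lipschitz continuous on $\mathbb{R}^m$ and that $$\liminf_{\mathcal K_2\ni k\to\infty}\frac{-\langle r^k,d^k_{S_k}\rangle}{\|r^k\|\,\|d^k_{S_k}\|}>0 .$$ (i) If $F$ is a KL function, then $\sum_k\|x^{k+1}-x^k\|<\infty$, and $\{x^k\}$ converges to an $L$-type stationary point $x^*$ of $F$. (ii) If, in addition, $F$ has the KL property of exponent $1/2$ at $x^*$, then $\{x^k\}$ converges R-linearly to $x^*$: there are $C>0$ and $\rho\in(0,1)$ with $\|x^k-x^*\|\le C\rho^k$ for all $k$. -/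

import Mathlib

open Filter Topology

noncomputable section

namespace HpgSRN

/-! ### General notions of variational analysis -/

/-- The Hessian `∇²h(x)`, as the continuous linear operator `D(∇h)(x)`. -/
def hess {E : Type*} [NormedAddCommGroup E] [InnerProductSpace ℝ E] [CompleteSpace E]
    (h : E → ℝ) (x : E) : E →L[ℝ] E :=
  fderiv ℝ (gradient h) x

/-- The smallest eigenvalue of a (self-adjoint) operator. -/
def lambdaMin {E : Type*} [NormedAddCommGroup E] [InnerProductSpace ℝ E] (H : E →L[ℝ] E) : ℝ :=
  sInf {t : ℝ | Module.End.HasEigenvalue (H : E →ₗ[ℝ] E) t}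

/-- The regular (Fréchet) subdifferential of a finite function `h` at `x`:
all `v` with `h y ≥ h x + ⟨v, y - x⟩ + o(‖y - x‖)`. -/
def regularSubdiff {E : Type*} [NormedAddCommGroup E] [InnerProductSpace ℝ E]
    (h : E → ℝ) (x : E) : Set E :=
  {v | ∀ ε : ℝ, 0 < ε → ∀ᶠ y in 𝓝 x, h x + inner ℝ v (y - x) - ε * ‖y - x‖ ≤ h y}

/-- The limiting (Mordukhovich) subdifferential `∂h(x)` of a finite function `h` at `x`. -/
def limitingSubdiff {E : Type*} [NormedAddCommGroup E] [InnerProductSpace ℝ E]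
    (h : E → ℝ) (x : E) : Set E :=
  {v | ∃ (y w : ℕ → E), Tendsto y atTop (𝓝 x) ∧ Tendsto (fun j => h (y j)) atTop (𝓝 (h x)) ∧
    (∀ j, w j ∈ regularSubdiff h (y j)) ∧ Tendsto w atTop (𝓝 v)}

/-- The function `φ : [0, η) → ℝ₊` is continuous, concave, vanishes at `0`, and is continuously
differentiable with positive derivative on `(0, η)`; here `η ∈ (0, ∞]`. -/
structure IsDesingularizing (η : EReal) (φ : ℝ → ℝ) : Prop where
  nonneg : ∀ s ∈ {s : ℝ | 0 ≤ s ∧ (s : EReal) < η}, 0 ≤ φ s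
  continuousOn : ContinuousOn φ {s : ℝ | 0 ≤ s ∧ (s : EReal) < η}
  concaveOn : ConcaveOn ℝ {s : ℝ | 0 ≤ s ∧ (s : EReal) < η} φ
  map_zero : φ 0 = 0
  contDiffOn : ContDiffOn ℝ 1 φ {s : ℝ | 0 < s ∧ (s : EReal) < η}
  deriv_pos : ∀ s ∈ {s : ℝ | 0 < s ∧ (s : EReal) < η}, 0 < deriv φ s

/-- The Kurdyka–Łojasiewicz inequality of `h` near `x₀` with the desingularizing function `φ` on
`[0, η)`. The distance to the empty set is `∞`. -/
def KLInequality {E : Type*} [NormedAddCommGroup E] [InnerProductSpace ℝ E]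
    (h : E → ℝ) (x₀ : E) (η : EReal) (φ : ℝ → ℝ) : Prop :=
  ∃ U ∈ 𝓝 x₀, ∀ x ∈ U, h x₀ < h x → ((h x - h x₀ : ℝ) : EReal) < η →
    1 ≤ ENNReal.ofReal (deriv φ (h x - h x₀)) * Metric.infEDist 0 (limitingSubdiff h x)

/-- The KL property of `h` at a point `x₀ ∈ dom ∂h`. -/
def HasKLProperty {E : Type*} [NormedAddCommGroup E] [InnerProductSpace ℝ E]
    (h : E → ℝ) (x₀ : E) : Prop :=
  (limitingSubdiff h x₀).Nonempty ∧
    ∃ (η : EReal) (φ : ℝ → ℝ), 0 < η ∧ IsDesingularizing η φ ∧ KLInequality h x₀ η φ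

/-- The KL property of exponent `1/2` at `x₀`: one can take `φ(s) = c √s` with `c > 0`. -/
def HasKLPropertyHalf {E : Type*} [NormedAddCommGroup E] [InnerProductSpace ℝ E]
    (h : E → ℝ) (x₀ : E) : Prop :=
  (limitingSubdiff h x₀).Nonempty ∧
    ∃ (η : EReal) (c : ℝ), 0 < η ∧ 0 < c ∧ KLInequality h x₀ η (fun s => c * √s)

/-- A KL function: the KL property holds at every point of `dom ∂h`. -/
def IsKLFunction {E : Type*} [NormedAddCommGroup E] [InnerProductSpace ℝ E]
    (h : E → ℝ) : Prop :=
  ∀ x, (limitingSubdiff h x).Nonempty → HasKLProperty h x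

/-- The (set-valued) proximal mapping `prox_{γ h}(y) = argmin_z { ‖z - y‖² / (2γ) + h z }`. -/
def prox {E : Type*} [NormedAddCommGroup E] (γ : ℝ) (h : E → ℝ) (y : E) : Set E :=
  {z | ∀ w, 1 / (2 * γ) * ‖z - y‖ ^ 2 + h z ≤ 1 / (2 * γ) * ‖w - y‖ ^ 2 + h w}

/-- R-linear convergence of `x` to `xstar`. -/
def ConvergesRLinearly {E : Type*} [NormedAddCommGroup E] (x : ℕ → E) (xstar : E) : Prop :=
  ∃ C ρ : ℝ, 0 < C ∧ 0 < ρ ∧ ρ < 1 ∧ ∀ k, ‖x k - xstar‖ ≤ C * ρ ^ k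

/-! ### The optimization problem

The index type `ι` of the variable is `Fin n` for the full problem and an index set
`S ⊆ {1, …, n}` for its restrictions to coordinate subspaces. -/

/-- `ψ(x) = f(Ax)`. -/
def smoothPart {m : ℕ} {ι : Type*} [Fintype ι] [DecidableEq ι]
    (f : EuclideanSpace ℝ (Fin m) → ℝ) (A : Matrix (Fin m) ι ℝ) (x : EuclideanSpace ℝ ι) : ℝ :=
  f (WithLp.toLp 2 (A.mulVec x.ofLp))

/-- `g(x) = ‖x‖_q^q = ∑ |x_i|^q`. -/
def lqPow {ι : Type*} [Fintype ι] (q : ℝ) (x : EuclideanSpace ℝ ι) : ℝ :=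
  ∑ i, |x i| ^ q

/-- `F(x) = f(Ax) + lam ‖x‖_q^q`. -/
def objective {m : ℕ} {ι : Type*} [Fintype ι] [DecidableEq ι]
    (f : EuclideanSpace ℝ (Fin m) → ℝ) (A : Matrix (Fin m) ι ℝ) (lam q : ℝ)
    (x : EuclideanSpace ℝ ι) : ℝ :=
  smoothPart f A x + lam * lqPow q x

/-- The support of `x`. -/
def supp {n : ℕ} (x : EuclideanSpace ℝ (Fin n)) : Finset (Fin n) :=
  Finset.univ.filter (fun i => x i ≠ 0)

/-- `|x|_min`, the smallest absolute value of the nonzero entries of `x` (only used for `x ≠ 0`). -/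
def absMin {n : ℕ} (x : EuclideanSpace ℝ (Fin n)) : ℝ :=
  sInf ((fun i => |x i|) '' {i | x i ≠ 0})

/-- The subvector `x_S`. -/
def subvec {n : ℕ} (S : Finset (Fin n)) (x : EuclideanSpace ℝ (Fin n)) : EuclideanSpace ℝ S :=
  WithLp.toLp 2 (fun i => x i)

/-- `F_S(u) = f(A_S u) + lam ∑_{i ∈ S} |u_i|^q`, with `A_S` the columns of `A` indexed by `S`. -/
def subObjective {m n : ℕ} (f : EuclideanSpace ℝ (Fin m) → ℝ) (A : Matrix (Fin m) (Fin n) ℝ)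
    (lam q : ℝ) (S : Finset (Fin n)) : EuclideanSpace ℝ S → ℝ :=
  objective f (A.submatrix id (Subtype.val : S → Fin n)) lam q

/-- The proximal gradient set `prox_{μ⁻¹(lam g)}(x - μ⁻¹ ∇ψ(x))`. -/
def proxGrad {m n : ℕ} (f : EuclideanSpace ℝ (Fin m) → ℝ) (A : Matrix (Fin m) (Fin n) ℝ)
    (lam q μ : ℝ) (x : EuclideanSpace ℝ (Fin n)) : Set (EuclideanSpace ℝ (Fin n)) :=
  prox μ⁻¹ (fun z => lam * lqPow q z) (x - μ⁻¹ • gradient (smoothPart f A) x)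

/-- `L`-type stationary points. -/
def IsLStationary {m n : ℕ} (f : EuclideanSpace ℝ (Fin m) → ℝ) (A : Matrix (Fin m) (Fin n) ℝ)
    (lam q : ℝ) (x : EuclideanSpace ℝ (Fin n)) : Prop :=
  ∃ μ : ℝ, 0 < μ ∧ x ∈ proxGrad f A lam q μ x

/-! ### The algorithm -/

/-- The parameters of the algorithm. -/
structure Params where
  (τ α μmin μmax σ ϱ β b₁ b₂ : ℝ)
  one_lt_τ : 1 < τ
  α_pos : 0 < α
  μmin_pos : 0 < μmin
  μmin_lt_μmax : μmin < μmax
  σ_pos : 0 < σ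
  σ_le : σ ≤ 1 / 2
  ϱ_pos : 0 < ϱ
  ϱ_lt : ϱ < 1 / 2
  β_pos : 0 < β
  β_lt : β < 1
  one_lt_b₁ : 1 < b₁
  b₂_pos : 0 < b₂

/-- `[xplus, μplus]` is a possible output of one proximal gradient step with monotone line search
from `x` with initial step-size `μ`: trial points `y j` are selected from the proximal gradient
set with step-sizes `τ^j μ`, and `l` is the first index whose trial point passes the decrease
test. -/
def IsPGOutput {m n : ℕ} (f : EuclideanSpace ℝ (Fin m) → ℝ) (A : Matrix (Fin m) (Fin n) ℝ)
    (lam q τ α : ℝ) (x : EuclideanSpace ℝ (Fin n)) (μ : ℝ)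
    (xplus : EuclideanSpace ℝ (Fin n)) (μplus : ℝ) : Prop :=
  ∃ (l : ℕ) (y : ℕ → EuclideanSpace ℝ (Fin n)),
    (∀ j ≤ l, y j ∈ proxGrad f A lam q (τ ^ j * μ) x) ∧
    (∀ j < l, objective f A lam q x - α / 2 * ‖y j - x‖ ^ 2 < objective f A lam q (y j)) ∧
    objective f A lam q (y l) ≤ objective f A lam q x - α / 2 * ‖y l - x‖ ^ 2 ∧
    xplus = y l ∧ μplus = τ ^ l * μ

/-- The switching condition: `sign x = sign xbar` and
`μbar + lam q (q-1) |x|_min^(q-2) ≥ ωbar / 2`, `ωbar = μbar + lam q (q-1) |xbar|_min^(q-2)`. -/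
def SwitchCond {n : ℕ} (lam q μbar : ℝ) (x xbar : EuclideanSpace ℝ (Fin n)) : Prop :=
  (∀ i, SignType.sign (x i) = SignType.sign (xbar i)) ∧
    (1 / 2) * (μbar + lam * q * (q - 1) * absMin xbar ^ (q - 2)) ≤
      μbar + lam * q * (q - 1) * absMin x ^ (q - 2)

/-- `∇F_S(x_S)` with `S = supp x`. -/
def subGrad {m n : ℕ} (f : EuclideanSpace ℝ (Fin m) → ℝ) (A : Matrix (Fin m) (Fin n) ℝ)
    (lam q : ℝ) (x : EuclideanSpace ℝ (Fin n)) : EuclideanSpace ℝ (supp x) :=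
  gradient (subObjective f A lam q (supp x)) (subvec (supp x) x)

/-- `∇²F_S(x_S)` with `S = supp x`. -/
def subHess {m n : ℕ} (f : EuclideanSpace ℝ (Fin m) → ℝ) (A : Matrix (Fin m) (Fin n) ℝ)
    (lam q : ℝ) (x : EuclideanSpace ℝ (Fin n)) :
    EuclideanSpace ℝ (supp x) →L[ℝ] EuclideanSpace ℝ (supp x) :=
  hess (subObjective f A lam q (supp x)) (subvec (supp x) x)

/-- The regularized Hessian `G = ∇²F_S(u) + (b₁ ζ + b₂ ‖∇F_S(u)‖^σ) I`, where `S = supp x`,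
`u = x_S`, and `ζ = [-λ_min(∇²F_S(u))]₊`. -/
def regHess {m n : ℕ} (f : EuclideanSpace ℝ (Fin m) → ℝ) (A : Matrix (Fin m) (Fin n) ℝ)
    (lam q : ℝ) (P : Params) (x : EuclideanSpace ℝ (Fin n)) :
    EuclideanSpace ℝ (supp x) →L[ℝ] EuclideanSpace ℝ (supp x) :=
  subHess f A lam q x +
    (P.b₁ * max (-lambdaMin (subHess f A lam q x)) 0 + P.b₂ * ‖subGrad f A lam q x‖ ^ P.σ) •
      ContinuousLinearMap.id ℝ (EuclideanSpace ℝ (supp x))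

/-- The Armijo condition with step `β^j` along `d` for `F_S`, `S = supp x`, at `x_S`. -/
def Armijo {m n : ℕ} (f : EuclideanSpace ℝ (Fin m) → ℝ) (A : Matrix (Fin m) (Fin n) ℝ)
    (lam q : ℝ) (P : Params) (x d : EuclideanSpace ℝ (Fin n)) (j : ℕ) : Prop :=
  subObjective f A lam q (supp x) (subvec (supp x) x + P.β ^ j • subvec (supp x) d) ≤
    subObjective f A lam q (supp x) (subvec (supp x) x) +
      P.ϱ * P.β ^ j * inner ℝ (subGrad f A lam q x) (subvec (supp x) d)

/-- An infinite run of the algorithm HpgSRN with tolerance `ε = 0` (so that the run not stopping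
at step `k` means `x k ≠ xbar k`). The values `d k`, `ls k` matter only at Newton steps. -/
structure Run {m n : ℕ} (f : EuclideanSpace ℝ (Fin m) → ℝ) (A : Matrix (Fin m) (Fin n) ℝ)
    (lam q : ℝ) (P : Params) where
  /-- the iterates -/
  x : ℕ → EuclideanSpace ℝ (Fin n)
  /-- the proximal gradient points -/
  xbar : ℕ → EuclideanSpace ℝ (Fin n)
  /-- the initial step-sizes of the proximal gradient steps -/
  μ : ℕ → ℝ
  /-- the accepted step-sizes of the proximal gradient steps -/
  μbar : ℕ → ℝ
  /-- the Newton directions, extended by zero outside the support -/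
  d : ℕ → EuclideanSpace ℝ (Fin n)
  /-- the line search exponents of the Newton steps -/
  ls : ℕ → ℕ
  μ_mem : ∀ k, μ k ∈ Set.Icc P.μmin P.μmax
  pg_step : ∀ k, IsPGOutput f A lam q P.τ P.α (x k) (μ k) (xbar k) (μbar k)
  not_stopped : ∀ k, x k ≠ xbar k
  next_pg : ∀ k, ¬ SwitchCond lam q (μbar k) (x k) (xbar k) → x (k + 1) = xbar k
  newton_eq : ∀ k, SwitchCond lam q (μbar k) (x k) (xbar k) →
    regHess f A lam q P (x k) (subvec (supp (x k)) (d k)) = -subGrad f A lam q (x k)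
  newton_off : ∀ k, SwitchCond lam q (μbar k) (x k) (xbar k) → ∀ i ∉ supp (x k), d k i = 0
  line_search : ∀ k, SwitchCond lam q (μbar k) (x k) (xbar k) →
    IsLeast {j : ℕ | Armijo f A lam q P (x k) (d k) j} (ls k)
  next_newton : ∀ k, SwitchCond lam q (μbar k) (x k) (xbar k) →
    x (k + 1) = x k + P.β ^ ls k • d k

namespace Run

variable {m n : ℕ} {f : EuclideanSpace ℝ (Fin m) → ℝ} {A : Matrix (Fin m) (Fin n) ℝ}
  {lam q : ℝ} {P : Params}

/-- The set `K₂` of indices of Newton steps. -/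
def K₂ (R : Run f A lam q P) : Set ℕ :=
  {k | SwitchCond lam q (R.μbar k) (R.x k) (R.xbar k)}

/-- `-⟨r^k, d^k_S⟩ / (‖r^k‖ ‖d^k_S‖)` with `S = supp x^k` and `r^k = ∇F_S(x^k_S)`. -/
def curveRatio (R : Run f A lam q P) (k : ℕ) : ℝ :=
  -inner ℝ (subGrad f A lam q (R.x k)) (subvec (supp (R.x k)) (R.d k)) /
    (‖subGrad f A lam q (R.x k)‖ * ‖subvec (supp (R.x k)) (R.d k)‖)

/-- The curve-ratio condition: the lower limit of the curve ratio along `K₂` is positive. -/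
def CurveRatioCondition (R : Run f A lam q P) : Prop :=
  0 < liminf (fun k => (R.curveRatio k : EReal)) (atTop ⊓ 𝓟 R.K₂)

end Run

end HpgSRN

end

/-!
The objective `F` is a smooth function plus `lam * ‖x‖_q^q`. Because the slope of `|t|^q` is
infinite at `0`, the limiting subdifferential of `F` at `x` contains the vector `redGrad x` that is
the gradient of the restriction of `F` to the support of `x`, extended by zero
(`redGrad_mem_regularSubdiff`). The convergence proof compares each step `x (k+1) - x k` with the
norm of this vector at its two end points.

From some index on, each step either decreases `F` by a multiple of its squared length (proximal
gradient step), or decreases it by a multiple of its length times `‖redGrad (x k)‖` (Newton step,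
where the curve-ratio condition turns the Armijo decrease into this form). In both cases
`‖redGrad (x (k+1))‖` is at most a multiple of the length of the step. For a proximal gradient step
this is its first-order condition. For a short Newton step, `redGrad` is Lipschitz continuous along
it, so that the claim amounts to a lower bound of the length by a multiple of `‖redGrad (x k)‖`;
this follows from the trial step which the line search rejected last, or from the Newton equation if
none was rejected (`exists_newton_step_estimates`).
The regularization bounds the Newton direction by a multiple of `‖redGrad‖^(1-σ)`, so that all steps
tend to zero (`Run.exists_isDescentSequence`).

The uniformity of the constants rests on a lower bound for nonzero entries: a nonzero entry of a
proximal gradient point is compared with zero (`proxGrad_lower_bound`), and the switching condition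
transfers the bound to the iterates from which Newton steps start (`SwitchCond.lower_bound`).

By concavity of the desingularizing function `φ`, the Kurdyka–Łojasiewicz inequality then yields
`‖Δ (k+1)‖ ≤ ‖Δ k‖ / 2 + const * (φ_(k+1) - φ_(k+2))` for consecutive steps `Δ` near a cluster point
(`IsDescentSequence.step_le`), whence the length is finite (`IsDescentSequence.summable`). For
exponent `1/2`, `φ_(k+1)` is itself at most a multiple of `‖Δ k‖`, and a suitable sum of the two
contracts (`IsDescentSequence.convergesRLinearly`).

The limit is `L`-stationary because proximal gradient points depend in a closed way on the data. If
almost all steps are Newton steps, the proximal gradient points are not iterates, and their limits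
are identified with that of the iterates by the strict convexity of the derivative of
`μ / 2 * t^2 + lam * t^q` on the positive axis (`eq_of_switchCond_limit`).
-/

namespace HpgSRN

/-! ### Descent sequences under the Kurdyka–Łojasiewicz inequality -/

section KL

variable {E : Type*} [NormedAddCommGroup E] [InnerProductSpace ℝ E]

lemma regularSubdiff_subset_limitingSubdiff (h : E → ℝ) (x : E) :
    regularSubdiff h x ⊆ limitingSubdiff h x := fun v hv =>
  ⟨fun _ => x, fun _ => v, tendsto_const_nhds, tendsto_const_nhds, fun _ => hv,
    tendsto_const_nhds⟩

lemma isDesingularizing_mul_sqrt (η : EReal) {c : ℝ} (hc : 0 < c) :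
    IsDesingularizing η (fun s => c * √s) where
  nonneg s _ := by positivity
  continuousOn := by fun_prop
  concaveOn := by
    have h1 : ConcaveOn ℝ (Set.Ici (0 : ℝ)) (fun s => c * √s) :=
      Real.strictConcaveOn_sqrt.concaveOn.smul hc.le
    refine h1.subset (fun s hs => hs.1) (Set.OrdConnected.convex ⟨?_⟩)
    intro a ha b hb z hz
    exact ⟨ha.1.trans hz.1, lt_of_le_of_lt (EReal.coe_le_coe_iff.2 hz.2) hb.2⟩
  map_zero := by simp
  contDiffOn := by
    intro s hs
    exact (contDiffAt_const.mul (Real.contDiffAt_sqrt hs.1.ne')).contDiffWithinAt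
  deriv_pos s hs := by
    have hs0 : 0 < s := hs.1
    rw [deriv_const_mul _ (Real.hasDerivAt_sqrt hs0.ne').differentiableAt,
      (Real.hasDerivAt_sqrt hs0.ne').deriv]
    positivity

lemma IsDesingularizing.deriv_mul_sub_le {η : EReal} {φ : ℝ → ℝ} (hφ : IsDesingularizing η φ)
    {a b : ℝ} (hb : 0 < b) (hba : b < a) (ha : (a : EReal) < η) :
    deriv φ a * (a - b) ≤ φ a - φ b := by
  have hbη : (b : EReal) < η := lt_trans (EReal.coe_lt_coe_iff.2 hba) ha
  have hopen : IsOpen {s : ℝ | 0 < s ∧ (s : EReal) < η} :=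
    isOpen_Ioi.inter (isOpen_lt continuous_coe_real_ereal continuous_const)
  have hd : DifferentiableAt ℝ φ a :=
    ((hφ.contDiffOn.differentiableOn one_ne_zero) a ⟨hb.trans hba, ha⟩).differentiableAt
      (hopen.mem_nhds ⟨hb.trans hba, ha⟩)
  have h := hφ.concaveOn.deriv_le_slope (x := b) (y := a) ⟨hb.le, hbη⟩
    ⟨(hb.trans hba).le, ha⟩ hba hd
  rw [slope_def_field, le_div_iff₀ (sub_pos.2 hba)] at h
  exact h

lemma KLInequality.eventually_one_le {h : E → ℝ} {x₀ : E} {η : EReal} {φ : ℝ → ℝ}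
    (hKL : KLInequality h x₀ η φ) (hφ : IsDesingularizing η φ) {r : E → E}
    (hr : ∀ x, r x ∈ limitingSubdiff h x) :
    ∀ᶠ x in 𝓝 x₀, h x₀ < h x → ((h x - h x₀ : ℝ) : EReal) < η →
      1 ≤ deriv φ (h x - h x₀) * ‖r x‖ := by
  obtain ⟨U, hU, hUx⟩ := hKL
  filter_upwards [hU] with x hx h1 h2
  have h3 := hUx x hx h1 h2
  have hd : 0 < deriv φ (h x - h x₀) := hφ.deriv_pos _ ⟨sub_pos.2 h1, h2⟩
  have h4 : Metric.infEDist 0 (limitingSubdiff h x) ≤ ENNReal.ofReal ‖r x‖ := by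
    refine (Metric.infEDist_le_edist_of_mem (hr x)).trans ?_
    rw [edist_dist, dist_zero_left]
  have h5 := h3.trans (mul_le_mul_right h4 _)
  rw [← ENNReal.ofReal_mul hd.le, ENNReal.one_le_ofReal] at h5
  exact h5

end KL

section Descent

variable {E : Type*} [NormedAddCommGroup E]

/-- From the index `K` on, the values of `h` decrease strictly along `x`, and each step either has
a decrease quadratic in its length, or a decrease proportional to its length times the norm of the
subgradient `r` at its starting point. In both cases the subgradient at its end point is bounded
by its length. -/
structure IsDescentSequence (h : E → ℝ) (r : E → E) (x : ℕ → E) (K : ℕ) (c C : ℝ) : Prop where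
  c_pos : 0 < c
  C_pos : 0 < C
  strict : ∀ k ≥ K, h (x (k + 1)) < h (x k)
  decrease : ∀ k ≥ K, c * ‖x (k + 1) - x k‖ ^ 2 ≤ h (x k) - h (x (k + 1)) ∨
    c * (‖r (x k)‖ * ‖x (k + 1) - x k‖) ≤ h (x k) - h (x (k + 1))
  subgrad_le : ∀ k ≥ K, ‖r (x (k + 1))‖ ≤ C * ‖x (k + 1) - x k‖

namespace IsDescentSequence

variable {h : E → ℝ} {r : E → E} {x : ℕ → E} {K : ℕ} {c C : ℝ}

lemma value_le (H : IsDescentSequence h r x K c C) {j k : ℕ} (hj : K ≤ j) (hjk : j ≤ k) :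
    h (x k) ≤ h (x j) := by
  induction k, hjk using Nat.le_induction with
  | base => exact le_rfl
  | succ k hk ih => exact (H.strict k (hj.trans hk)).le.trans ih

lemma tendsto_value (H : IsDescentSequence h r x K c C) (hc : Continuous h) {x₀ : E}
    (hx₀ : MapClusterPt x₀ atTop x) : Tendsto (fun k => h (x k)) atTop (𝓝 (h x₀)) := by
  have hcl : MapClusterPt (h x₀) atTop (fun k => h (x k)) := hx₀.tendsto_comp hc.continuousAt
  have hlow : ∀ k ≥ K, h x₀ ≤ h (x k) := by
    intro k hk
    by_contra! hlt
    obtain ⟨j, hj1, hj2⟩ :=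
      ((hcl.frequently (lt_mem_nhds hlt)).and_eventually (eventually_ge_atTop k)).exists
    exact absurd (H.value_le hk hj2) (not_le.2 hj1)
  refine tendsto_order.2 ⟨fun a ha => ?_, fun a ha => ?_⟩
  · filter_upwards [eventually_ge_atTop K] with k hk using ha.trans_le (hlow k hk)
  · obtain ⟨j, hj1, hj2⟩ :=
      ((hcl.frequently (gt_mem_nhds ha)).and_eventually (eventually_ge_atTop K)).exists
    filter_upwards [eventually_ge_atTop j] with k hk using (H.value_le hj2 hk).trans_lt hj1

lemma lt_value (H : IsDescentSequence h r x K c C) {x₀ : E}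
    (hlim : Tendsto (fun k => h (x k)) atTop (𝓝 (h x₀))) {k : ℕ} (hk : K ≤ k) :
    h x₀ < h (x k) := by
  refine lt_of_le_of_lt ?_ (H.strict k hk)
  refine le_of_tendsto hlim ?_
  filter_upwards [eventually_ge_atTop (k + 1)] with j hj using H.value_le (by omega) hj

/-- Under the KL inequality, the length of a step is at most half of the length of the previous
step, up to a multiple of the decrease of the desingularized values. -/
lemma step_le (H : IsDescentSequence h r x K c C) {η : EReal} {φ : ℝ → ℝ}
    (hφ : IsDesingularizing η φ) {x₀ : E} {k : ℕ} (hk : K ≤ k)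
    (h1 : h x₀ < h (x (k + 2))) (h2 : ((h (x (k + 1)) - h x₀ : ℝ) : EReal) < η)
    (hKL : 1 ≤ deriv φ (h (x (k + 1)) - h x₀) * ‖r (x (k + 1))‖) :
    ‖x (k + 2) - x (k + 1)‖ ≤ 1 / 2 * ‖x (k + 1) - x k‖ + (C / (2 * c) + 1 / c) *
      (φ (h (x (k + 1)) - h x₀) - φ (h (x (k + 2)) - h x₀)) := by
  have hc := H.c_pos
  have hC := H.C_pos
  have hs := H.strict (k + 1) (by omega)
  have hslope := hφ.deriv_mul_sub_le (a := h (x (k + 1)) - h x₀) (b := h (x (k + 2)) - h x₀)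
    (sub_pos.2 h1) (by linarith) h2
  have hd : 0 < deriv φ (h (x (k + 1)) - h x₀) := hφ.deriv_pos _ ⟨by linarith, h2⟩
  have hr := H.subgrad_le k hk
  have hdec := H.decrease (k + 1) (by omega)
  rw [show k + 1 + 1 = k + 2 by omega] at hs hdec
  generalize deriv φ (h (x (k + 1)) - h x₀) = p at *
  generalize φ (h (x (k + 1)) - h x₀) - φ (h (x (k + 2)) - h x₀) = δ at *
  generalize ‖r (x (k + 1))‖ = D at *
  have ha := norm_nonneg (x (k + 2) - x (k + 1))
  have hb := norm_nonneg (x (k + 1) - x k)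
  generalize ‖x (k + 2) - x (k + 1)‖ = a at *
  generalize ‖x (k + 1) - x k‖ = b at *
  have hδ' : p * (h (x (k + 1)) - h (x (k + 2))) ≤ δ := by
    refine le_trans (le_of_eq ?_) hslope; ring
  have hδ : 0 ≤ δ := le_trans (mul_nonneg hd.le (by linarith)) hδ'
  rcases hdec with hdec | hdec
  · have h3 : p * (c * a ^ 2) ≤ δ := (mul_le_mul_of_nonneg_left hdec hd.le).trans hδ'
    have h4 : 1 ≤ p * (C * b) := hKL.trans (mul_le_mul_of_nonneg_left hr hd.le)
    -- the decrease and the bound on the subgradient combine to a geometric mean estimate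
    have h5 : a ^ 2 ≤ (C / c * δ) * b := by
      have h6 : a ^ 2 * 1 ≤ a ^ 2 * (p * (C * b)) := by gcongr
      calc a ^ 2 ≤ a ^ 2 * (p * (C * b)) := by linarith
        _ = C / c * (p * (c * a ^ 2)) * b := by field_simp
        _ ≤ C / c * δ * b := by gcongr
    have h6 : a ≤ (C / c * δ + b) / 2 := by
      have : 0 ≤ C / c * δ := by positivity
      refine abs_le_of_sq_le_sq' ?_ (by positivity) |>.2
      nlinarith [sq_nonneg (C / c * δ - b)]
    have h7 : C / c * δ / 2 = C / (2 * c) * δ := by ring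
    have h8 : 0 ≤ 1 / c * δ := by positivity
    linarith
  · have h3 : p * (c * (D * a)) ≤ δ := (mul_le_mul_of_nonneg_left hdec hd.le).trans hδ'
    have h4 : a ≤ 1 / c * δ := by
      have h6 : a * 1 ≤ a * (p * D) := by gcongr
      calc a ≤ a * (p * D) := by linarith
        _ = 1 / c * (p * (c * (D * a))) := by field_simp
        _ ≤ 1 / c * δ := by gcongr
    have h8 : 0 ≤ C / (2 * c) * δ := by positivity
    linarith

variable [InnerProductSpace ℝ E]

/-- A descent sequence whose steps tend to zero has finite length as soon as it has a cluster point
at which the KL property holds: once it is close enough to that point, it cannot leave the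
neighbourhood in which the KL inequality controls its length. -/
theorem summable (H : IsDescentSequence h r x K c C) (hcont : Continuous h)
    (hr : ∀ y, r y ∈ limitingSubdiff h y)
    (hstep : Tendsto (fun k => ‖x (k + 1) - x k‖) atTop (𝓝 0)) {x₀ : E}
    (hx₀ : MapClusterPt x₀ atTop x) (hKL : HasKLProperty h x₀) :
    Summable fun k => ‖x (k + 1) - x k‖ := by
  obtain ⟨-, η, φ, hη, hφ, hKL⟩ := hKL
  have hlim := H.tendsto_value hcont hx₀
  have hlt : ∀ k ≥ K, h x₀ < h (x k) := fun k hk => H.lt_value hlim hk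
  obtain ⟨ε, hε, hball⟩ := Metric.eventually_nhds_iff.1 (hKL.eventually_one_le hφ hr)
  set B := C / (2 * c) + 1 / c with hB
  have hBpos : 0 < B := by have := H.c_pos; have := H.C_pos; positivity
  have hsub : Tendsto (fun k => h (x k) - h x₀) atTop (𝓝 0) := by
    simpa using hlim.sub_const (h x₀)
  have hη' : ∀ᶠ k in atTop, ((h (x k) - h x₀ : ℝ) : EReal) < η := by
    have := (continuous_coe_real_ereal.tendsto 0).comp hsub
    exact this.eventually (gt_mem_nhds (by simpa using hη))
  have hφlim : Tendsto (fun k => φ (h (x k) - h x₀)) atTop (𝓝 0) := by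
    have h0 : ContinuousWithinAt φ {s : ℝ | 0 ≤ s ∧ (s : EReal) < η} 0 :=
      hφ.continuousOn 0 ⟨le_rfl, by simpa using hη⟩
    rw [ContinuousWithinAt, hφ.map_zero] at h0
    refine h0.comp (tendsto_nhdsWithin_iff.2 ⟨hsub, ?_⟩)
    filter_upwards [hη', eventually_ge_atTop K] with k hk hk'
    exact ⟨(sub_pos.2 (hlt k hk')).le, hk⟩
  have hstep' : ∀ᶠ k in atTop, ‖x (k + 1) - x k‖ < ε / 4 :=
    hstep.eventually (gt_mem_nhds (by positivity))
  have hφ' : ∀ᶠ k in atTop, B * φ (h (x k) - h x₀) < ε / 8 := by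
    have := hφlim.const_mul B
    rw [mul_zero] at this
    exact this.eventually (gt_mem_nhds (by positivity))
  obtain ⟨K₁, hK₁⟩ := eventually_atTop.1
    (hη'.and (hstep'.and (hφ'.and (eventually_ge_atTop K))))
  obtain ⟨N, hN1, hN2⟩ := ((hx₀.frequently (Metric.ball_mem_nhds x₀ (show 0 < ε / 4 by
    positivity))).and_eventually (eventually_ge_atTop (K₁ + 1))).exists
  obtain ⟨M, rfl⟩ : ∃ M, N = M + 1 := ⟨N - 1, by omega⟩
  have hφnn : ∀ k ≥ K₁, 0 ≤ φ (h (x k) - h x₀) := fun k hk =>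
    hφ.nonneg _ ⟨(sub_pos.2 (hlt k (hK₁ k hk).2.2.2)).le, (hK₁ k hk).1⟩
  -- this bound on the length so far keeps the iterates in the ball, where `step_le` propagates it
  have hbound : ∀ i, 1 / 2 * ∑ j ∈ Finset.range i, ‖x (j + 1 + (M + 1)) - x (j + (M + 1))‖
      + 1 / 2 * ‖x (i + (M + 1)) - x (i + M)‖ + B * φ (h (x (i + (M + 1))) - h x₀)
      ≤ 1 / 2 * ‖x (M + 1) - x M‖ + B * φ (h (x (M + 1)) - h x₀) := by
    intro i
    induction i with
    | zero => simp
    | succ i ih =>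
      have hM := hK₁ M (by omega)
      have hM1 := hK₁ (M + 1) (by omega)
      have hi1 := hφnn (i + (M + 1)) (by omega)
      have hdist : dist (x (i + (M + 1))) x₀ < ε := by
        have h1 : dist (x (0 + (M + 1))) (x (i + (M + 1))) ≤
            ∑ j ∈ Finset.range i, ‖x (j + 1 + (M + 1)) - x (j + (M + 1))‖ := by
          refine (dist_le_range_sum_dist (fun j => x (j + (M + 1))) i).trans (le_of_eq ?_)
          exact Finset.sum_congr rfl fun j _ => by rw [dist_comm, dist_eq_norm]
        have h2 := dist_triangle (x (i + (M + 1))) (x (M + 1)) x₀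
        rw [zero_add, dist_comm] at h1
        have h3 : dist (x (M + 1)) x₀ < ε / 4 := hN1
        have h4 := norm_nonneg (x (i + (M + 1)) - x (i + M))
        have h5 := mul_nonneg hBpos.le hi1
        linarith [hM.2.1, hM1.2.2.1]
      have hstepi := H.step_le hφ (x₀ := x₀) (k := i + M) (hK₁ (i + M) (by omega)).2.2.2
        (hlt _ (hK₁ (i + M + 2) (by omega)).2.2.2) (hK₁ (i + M + 1) (by omega)).1
        (hball hdist (hlt _ (hK₁ (i + M + 1) (by omega)).2.2.2) (hK₁ (i + M + 1) (by omega)).1)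
      rw [Finset.sum_range_succ]
      rw [show i + 1 + (M + 1) = i + M + 2 by omega, show i + 1 + M = i + M + 1 by omega]
      rw [show i + (M + 1) = i + M + 1 by omega] at ih ⊢
      linarith
  rw [← summable_nat_add_iff (M + 1)]
  refine summable_of_sum_range_le (c := ‖x (M + 1) - x M‖ + 2 * (B * φ (h (x (M + 1)) - h x₀)))
    (fun _ => norm_nonneg _) fun i => ?_
  have h1 := hbound i
  have h2 := norm_nonneg (x (i + (M + 1)) - x (i + M))
  have h3 := mul_nonneg hBpos.le (hφnn (i + (M + 1)) (by omega))
  have h4 : ∑ j ∈ Finset.range i, ‖x (j + (M + 1) + 1) - x (j + (M + 1))‖ =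
      ∑ j ∈ Finset.range i, ‖x (j + 1 + (M + 1)) - x (j + (M + 1))‖ :=
    Finset.sum_congr rfl fun j _ => by rw [show j + (M + 1) + 1 = j + 1 + (M + 1) by omega]
  rw [h4]
  linarith

/-- With exponent `1/2`, the length of the last step plus a multiple of the square root of the
optimality gap contracts geometrically. -/
theorem convergesRLinearly (H : IsDescentSequence h r x K c C) (hcont : Continuous h)
    (hr : ∀ y, r y ∈ limitingSubdiff h y) {x₀ : E} (hx₀ : Tendsto x atTop (𝓝 x₀))
    (hKL : HasKLPropertyHalf h x₀) : ConvergesRLinearly x x₀ := by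
  obtain ⟨-, η, κ, hη, hκ, hKL⟩ := hKL
  have hφ := isDesingularizing_mul_sqrt η hκ
  have hlim : Tendsto (fun k => h (x k)) atTop (𝓝 (h x₀)) := (hcont.tendsto x₀).comp hx₀
  have hlt : ∀ k ≥ K, h x₀ < h (x k) := fun k hk => H.lt_value hlim hk
  set B := C / (2 * c) + 1 / c with hB
  have hC := H.C_pos
  have hBpos : 0 < B := by have := H.c_pos; positivity
  have hη' : ∀ᶠ k in atTop, ((h (x k) - h x₀ : ℝ) : EReal) < η := by
    have hsub : Tendsto (fun k => h (x k) - h x₀) atTop (𝓝 0) := by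
      simpa using hlim.sub_const (h x₀)
    have := (continuous_coe_real_ereal.tendsto 0).comp hsub
    exact this.eventually (gt_mem_nhds (by simpa using hη))
  obtain ⟨K₁, hK₁⟩ := eventually_atTop.1
    (hη'.and ((hx₀.eventually (hKL.eventually_one_le hφ hr)).and (eventually_ge_atTop K)))
  -- `V i` is the last step plus the desingularized gap
  set V : ℕ → ℝ := fun i => ‖x (i + K₁ + 1) - x (i + K₁)‖ +
    B * (κ * √(h (x (i + K₁ + 1)) - h x₀)) with hV
  have hVnn : ∀ i, 0 ≤ V i := fun i => by positivity
  set Q := 1 + B * (κ ^ 2 / 2 * C) with hQ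
  have hQ1 : 1 < Q := by rw [hQ]; have : 0 < B * (κ ^ 2 / 2 * C) := by positivity
                         linarith
  have hcontr : ∀ i, V (i + 1) ≤ (1 - 1 / (2 * Q)) * V i := by
    intro i
    have h0 := (hK₁ (i + K₁ + 1) (by omega))
    have hpos := sub_pos.2 (hlt (i + K₁ + 1) h0.2.2)
    have hone := h0.2.1 (hlt _ h0.2.2) h0.1
    have hst := H.step_le hφ (x₀ := x₀) (k := i + K₁) (hK₁ (i + K₁) (by omega)).2.2
      (hlt _ (hK₁ (i + K₁ + 2) (by omega)).2.2) h0.1 hone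
    have hd := (Real.hasDerivAt_sqrt hpos.ne')
    rw [deriv_const_mul _ hd.differentiableAt, hd.deriv] at hone
    have hsq : 0 < √(h (x (i + K₁ + 1)) - h x₀) := Real.sqrt_pos.2 hpos
    have hgap : κ * √(h (x (i + K₁ + 1)) - h x₀) ≤
        κ ^ 2 / 2 * C * ‖x (i + K₁ + 1) - x (i + K₁)‖ := by
      have h2 := H.subgrad_le (i + K₁) (hK₁ (i + K₁) (by omega)).2.2
      have h3 : √(h (x (i + K₁ + 1)) - h x₀) ≤ κ / 2 * ‖r (x (i + K₁ + 1))‖ := by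
        have := mul_le_mul_of_nonneg_left hone hsq.le
        calc _ = √(h (x (i + K₁ + 1)) - h x₀) * 1 := by ring
          _ ≤ _ := this
          _ = _ := by field_simp
      calc _ ≤ κ * (κ / 2 * (C * ‖x (i + K₁ + 1) - x (i + K₁)‖)) := by
            gcongr; exact h3.trans (by gcongr)
        _ = _ := by ring
    have hVle : V i ≤ Q * ‖x (i + K₁ + 1) - x (i + K₁)‖ := by
      have := mul_le_mul_of_nonneg_left hgap hBpos.le
      simp only [hV, hQ]; linarith
    have hVle' : 1 / (2 * Q) * V i ≤ 1 / 2 * ‖x (i + K₁ + 1) - x (i + K₁)‖ := by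
      calc _ ≤ 1 / (2 * Q) * (Q * ‖x (i + K₁ + 1) - x (i + K₁)‖) := by gcongr
        _ = _ := by field_simp
    have : V (i + 1) ≤ V i - 1 / 2 * ‖x (i + K₁ + 1) - x (i + K₁)‖ := by
      simp only [hV]
      rw [show i + 1 + K₁ + 1 = i + K₁ + 2 by omega, show i + 1 + K₁ = i + K₁ + 1 by omega]
      linarith
    linarith
  set ρ := 1 - 1 / (2 * Q) with hρ
  have hρ0 : 0 < ρ := by
    rw [hρ, sub_pos, div_lt_one (by positivity)]; linarith
  have hρ1 : ρ < 1 := by rw [hρ]; have : 0 < 1 / (2 * Q) := by positivity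
                         linarith
  have hgeo : ∀ i, V i ≤ V 0 * ρ ^ i := by
    intro i
    induction i with
    | zero => simp
    | succ i ih => calc _ ≤ ρ * V i := hcontr i
        _ ≤ ρ * (V 0 * ρ ^ i) := by gcongr
        _ = _ := by ring
  have hdist : ∀ i, dist (x (i + K₁)) x₀ ≤ V 0 * ρ ^ i / (1 - ρ) := by
    refine dist_le_of_le_geometric_of_tendsto (f := fun i => x (i + K₁)) ρ (V 0) hρ1
      (fun i => ?_) ((tendsto_add_atTop_iff_nat K₁).2 hx₀)
    rw [dist_comm, dist_eq_norm, show i + 1 + K₁ = i + K₁ + 1 by omega]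
    refine le_trans ?_ (hgeo i)
    have : 0 ≤ B * (κ * √(h (x (i + K₁ + 1)) - h x₀)) := by positivity
    simp only [hV]; linarith
  -- the finitely many initial indices only enlarge the constant
  set C₀ := V 0 / (1 - ρ) / ρ ^ K₁ + ∑ j ∈ Finset.range K₁, ‖x j - x₀‖ / ρ ^ j + 1 with hC₀
  have h1ρ : 0 < 1 - ρ := by linarith
  have hA : 0 ≤ V 0 / (1 - ρ) / ρ ^ K₁ := by have := hVnn 0; positivity
  have hS : 0 ≤ ∑ j ∈ Finset.range K₁, ‖x j - x₀‖ / ρ ^ j :=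
    Finset.sum_nonneg fun j _ => by positivity
  refine ⟨C₀, ρ, by linarith, hρ0, hρ1, fun k => ?_⟩
  rcases lt_or_ge k K₁ with hk | hk
  · rw [← div_le_iff₀ (by positivity)]
    have : ‖x k - x₀‖ / ρ ^ k ≤ ∑ j ∈ Finset.range K₁, ‖x j - x₀‖ / ρ ^ j :=
      Finset.single_le_sum (f := fun j => ‖x j - x₀‖ / ρ ^ j) (fun j _ => by positivity)
        (Finset.mem_range.2 hk)
    linarith
  · obtain ⟨i, rfl⟩ := Nat.exists_eq_add_of_le' hk
    rw [← dist_eq_norm]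
    calc _ ≤ V 0 * ρ ^ i / (1 - ρ) := hdist i
      _ = V 0 / (1 - ρ) / ρ ^ K₁ * ρ ^ (i + K₁) := by rw [pow_add]; field_simp
      _ ≤ C₀ * ρ ^ (i + K₁) := by gcongr; linarith

end IsDescentSequence

end Descent

/-! ### The objective function and its reduced gradient -/

section Smooth

variable {m : ℕ} {ι : Type*} [Fintype ι] [DecidableEq ι] {f : EuclideanSpace ℝ (Fin m) → ℝ}

lemma smoothPart_eq_comp (f : EuclideanSpace ℝ (Fin m) → ℝ) (A : Matrix (Fin m) ι ℝ) :
    smoothPart f A = f ∘ LinearMap.toContinuousLinearMap (Matrix.toLpLin 2 2 A) := rfl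

lemma contDiff_smoothPart (hf : ContDiff ℝ 2 f) (A : Matrix (Fin m) ι ℝ) :
    ContDiff ℝ 2 (smoothPart f A) := by
  rw [smoothPart_eq_comp]
  exact hf.comp (ContinuousLinearMap.contDiff _)

end Smooth

section General

variable {E : Type*} [NormedAddCommGroup E] [InnerProductSpace ℝ E]

/-- Along the ray from `x` in direction `d`, the mean value theorem gives the upper quadratic bound,
with constant `M` in place of the optimal `M / 2`. -/
lemma le_add_of_lipschitz_line {h : E → ℝ} {g : E → E} {x d : E} {t M : ℝ} (ht : 0 ≤ t)
    (hderiv : ∀ s ∈ Set.Icc 0 t,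
      HasDerivAt (fun s : ℝ => h (x + s • d)) (inner ℝ (g (x + s • d)) d) s)
    (hlip : ∀ s ∈ Set.Icc 0 t, ‖g (x + s • d) - g x‖ ≤ M * ‖s • d‖) (hM : 0 ≤ M) :
    h (x + t • d) ≤ h x + t * inner ℝ (g x) d + M * t ^ 2 * ‖d‖ ^ 2 := by
  rcases ht.eq_or_lt with rfl | ht
  · simp
  obtain ⟨s, hs, hs'⟩ := exists_hasDerivAt_eq_slope (fun s : ℝ => h (x + s • d))
    (fun s => inner ℝ (g (x + s • d)) d) ht
    (fun s hs => (hderiv s hs).continuousAt.continuousWithinAt)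
    (fun s hs => hderiv s ⟨hs.1.le, hs.2.le⟩)
  rw [eq_div_iff (by linarith)] at hs'
  simp only [zero_smul, add_zero, sub_zero] at hs'
  have h1 : inner ℝ (g (x + s • d)) d - inner ℝ (g x) d ≤ M * t * ‖d‖ ^ 2 := by
    rw [← inner_sub_left]
    refine (real_inner_le_norm _ _).trans ?_
    calc _ ≤ (M * ‖s • d‖) * ‖d‖ := by gcongr; exact hlip s ⟨hs.1.le, hs.2.le⟩
      _ = M * s * ‖d‖ ^ 2 := by rw [norm_smul, Real.norm_of_nonneg hs.1.le]; ring
      _ ≤ _ := by gcongr; exact hs.2.le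
  nlinarith

variable [CompleteSpace E]

lemma _root_.ContDiff.gradient {h : E → ℝ} (hh : ContDiff ℝ 2 h) : ContDiff ℝ 1 (gradient h) :=
  (InnerProductSpace.toDual ℝ E).symm.contDiff.comp (hh.fderiv_right (by norm_num))

lemma exists_gradient_lipschitz_of_norm_le [FiniteDimensional ℝ E] {h : E → ℝ}
    (hh : ContDiff ℝ 2 h) (B : ℝ) :
    ∃ L : ℝ, 0 < L ∧ ∀ x y, ‖x‖ ≤ B → ‖y‖ ≤ B →
      ‖gradient h x - gradient h y‖ ≤ L * ‖x - y‖ := by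
  obtain ⟨K, hK⟩ := hh.gradient.contDiffOn.exists_lipschitzOnWith one_ne_zero
    (convex_closedBall (0 : E) B) (isCompact_closedBall 0 B)
  refine ⟨K + 1, by positivity, fun x y hx hy => ?_⟩
  have := hK.dist_le_mul x (by simpa using hx) y (by simpa using hy)
  rw [dist_eq_norm, dist_eq_norm] at this
  nlinarith [norm_nonneg (x - y)]

lemma le_add_of_gradient_lipschitz {h : E → ℝ} (hh : Differentiable ℝ h) {B L : ℝ} (hL : 0 ≤ L)
    (hlip : ∀ x y, ‖x‖ ≤ B → ‖y‖ ≤ B → ‖gradient h x - gradient h y‖ ≤ L * ‖x - y‖) {x y : E}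
    (hx : ‖x‖ ≤ B) (hy : ‖y‖ ≤ B) :
    h y ≤ h x + inner ℝ (gradient h x) (y - x) + L * ‖y - x‖ ^ 2 := by
  have hseg : ∀ s ∈ Set.Icc (0 : ℝ) 1, ‖x + s • (y - x)‖ ≤ B := by
    intro s hs
    have := (convex_closedBall (0 : E) B).add_smul_sub_mem (by simpa using hx) (by simpa using hy)
      hs
    simpa using this
  have := le_add_of_lipschitz_line (h := h) (g := gradient h) (x := x) (d := y - x) (t := 1)
    zero_le_one (fun s _ => ?_) (fun s hs => ?_) hL
  · simpa using this
  · have h1 := (hh (x + s • (y - x))).hasGradientAt.hasFDerivAt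
    have h2 : HasDerivAt (fun s : ℝ => x + s • (y - x)) (y - x) s := by
      simpa using ((hasDerivAt_id s).smul_const (y - x)).const_add x
    have h3 := h1.comp_hasDerivAt s h2
    rwa [InnerProductSpace.toDual_apply_apply] at h3
  · simpa using hlip _ x (hseg s hs) hx

end General

/-- The derivative `q |t|^(q-1) sign t` of `|t|^q` at `t ≠ 0`. -/
noncomputable def powDeriv (q t : ℝ) : ℝ := q * |t| ^ (q - 1) * SignType.sign t

lemma hasDerivAt_abs_rpow_of_ne (q : ℝ) {t : ℝ} (ht : t ≠ 0) :
    HasDerivAt (fun s : ℝ => |s| ^ q) (powDeriv q t) t := by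
  have := (hasDerivAt_abs ht).rpow_const (p := q) (Or.inl (abs_ne_zero.2 ht))
  convert this using 1
  unfold powDeriv; ring

lemma exists_powDeriv_lipschitz {q ν : ℝ} (hq0 : 0 < q) (hq1 : q < 1) (hν : 0 < ν) :
    ∃ K : ℝ, 0 ≤ K ∧ ∀ a b : ℝ, SignType.sign a = SignType.sign b → ν ≤ |a| → ν ≤ |b| →
      |powDeriv q a - powDeriv q b| ≤ K * |a - b| := by
  refine ⟨q * ((1 - q) * ν ^ (q - 2)), by have := sub_pos.2 hq1; positivity,
    fun a b hab ha hb => ?_⟩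
  have hpow : |(|a| ^ (q - 1) - |b| ^ (q - 1))| ≤ (1 - q) * ν ^ (q - 2) * |a - b| := by
    have h1 := (convex_Ici ν).norm_image_sub_le_of_norm_hasDerivWithin_le
      (f := fun s : ℝ => s ^ (q - 1)) (f' := fun s => (q - 1) * s ^ (q - 1 - 1))
      (C := (1 - q) * ν ^ (q - 2)) (x := |b|) (y := |a|)
      (fun s hs => (Real.hasDerivAt_rpow_const (Or.inl (hν.trans_le hs).ne')).hasDerivWithinAt)
      (fun s hs => ?_) hb ha
    · refine h1.trans ?_
      have := abs_abs_sub_abs_le_abs_sub a b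
      have h2 := sub_pos.2 hq1
      rw [Real.norm_eq_abs]
      gcongr
    · have hs0 : 0 < s := hν.trans_le hs
      rw [norm_mul, Real.norm_of_nonpos (by linarith), Real.norm_of_nonneg (by positivity),
        show q - 1 - 1 = q - 2 by ring, neg_sub]
      have := Real.rpow_le_rpow_of_nonpos hν hs (show q - 2 ≤ 0 by linarith)
      have h2 := sub_pos.2 hq1
      gcongr
  have hsign : |((SignType.sign b : SignType) : ℝ)| ≤ 1 := by
    rcases lt_trichotomy b 0 with h | h | h <;> simp [h]
  calc |powDeriv q a - powDeriv q b|
      = q * |(|a| ^ (q - 1) - |b| ^ (q - 1))| * |((SignType.sign b : SignType) : ℝ)| := by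
        rw [powDeriv, powDeriv, hab, ← sub_mul, ← mul_sub, abs_mul, abs_mul, abs_of_pos hq0]
    _ ≤ q * ((1 - q) * ν ^ (q - 2) * |a - b|) * 1 := by gcongr
    _ = _ := by ring

section Objective

variable {m n : ℕ} {f : EuclideanSpace ℝ (Fin m) → ℝ} {A : Matrix (Fin m) (Fin n) ℝ} {lam q : ℝ}

/-- The gradient of the objective restricted to the coordinate subspace of the support of `x`,
extended by zero. -/
noncomputable def redGrad (f : EuclideanSpace ℝ (Fin m) → ℝ) (A : Matrix (Fin m) (Fin n) ℝ)
    (lam q : ℝ) (x : EuclideanSpace ℝ (Fin n)) : EuclideanSpace ℝ (Fin n) :=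
  WithLp.toLp 2 fun i =>
    if x i = 0 then 0 else gradient (smoothPart f A) x i + lam * powDeriv q (x i)

lemma redGrad_of_eq_zero {x : EuclideanSpace ℝ (Fin n)} {i : Fin n} (h : x i = 0) :
    redGrad f A lam q x i = 0 := by simp [redGrad, h]

lemma redGrad_of_ne_zero {x : EuclideanSpace ℝ (Fin n)} {i : Fin n} (h : x i ≠ 0) :
    redGrad f A lam q x i = gradient (smoothPart f A) x i + lam * powDeriv q (x i) := by
  simp [redGrad, h]

lemma continuous_lqPow {ι : Type*} [Fintype ι] (hq0 : 0 < q) :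
    Continuous (lqPow q : EuclideanSpace ℝ ι → ℝ) := by
  unfold lqPow
  refine continuous_finsetSum _ fun i _ => ?_
  have : Continuous fun x : EuclideanSpace ℝ ι => |x i| := by fun_prop
  exact this.rpow_const fun _ => Or.inr hq0.le

lemma lqPow_nonneg {ι : Type*} [Fintype ι] (q : ℝ) (x : EuclideanSpace ℝ ι) : 0 ≤ lqPow q x :=
  Finset.sum_nonneg fun _ _ => by positivity

lemma continuous_objective (hf : ContDiff ℝ 2 f) (hq0 : 0 < q) :
    Continuous (objective f A lam q) := by
  unfold objective
  exact (contDiff_smoothPart hf A).continuous.add (continuous_const.mul (continuous_lqPow hq0))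

lemma norm_le_of_forall_abs_le {x y : EuclideanSpace ℝ (Fin n)} (h : ∀ i, |x i| ≤ |y i|) :
    ‖x‖ ≤ ‖y‖ := by
  rw [EuclideanSpace.norm_eq, EuclideanSpace.norm_eq]
  refine Real.sqrt_le_sqrt (Finset.sum_le_sum fun i _ => ?_)
  exact pow_le_pow_left₀ (norm_nonneg _) (h i) 2

lemma norm_le_mul_of_forall_abs_le {x : EuclideanSpace ℝ (Fin n)} {C : ℝ} (hC : 0 ≤ C)
    (h : ∀ i, |x i| ≤ C) : ‖x‖ ≤ √n * C := by
  refine (norm_le_of_forall_abs_le (y := WithLp.toLp 2 fun _ => C) fun i => ?_).trans ?_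
  · simpa [abs_of_nonneg hC] using h i
  · simp [EuclideanSpace.norm_eq, abs_of_nonneg hC, Real.sqrt_sq hC]

/-- The objective has bounded sublevel sets. -/
lemma exists_norm_le_of_objective_le (hbdd : BddBelow (Set.range f)) (hlam : 0 < lam)
    (hq0 : 0 < q) (a : ℝ) :
    ∃ B : ℝ, ∀ x, objective f A lam q x ≤ a → ‖x‖ ≤ B := by
  obtain ⟨b, hb⟩ := hbdd
  refine ⟨√n * (max ((a - b) / lam) 0) ^ (1 / q), fun x hx =>
    norm_le_mul_of_forall_abs_le (by positivity) fun i => ?_⟩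
  have h1 : b ≤ smoothPart f A x := hb ⟨_, rfl⟩
  have h2 : |x i| ^ q ≤ lqPow q x :=
    Finset.single_le_sum (f := fun i => |x i| ^ q) (fun _ _ => by positivity) (Finset.mem_univ i)
  have h3 : |x i| ^ q ≤ (a - b) / lam := by
    rw [le_div_iff₀ hlam]
    unfold objective at hx
    nlinarith
  have h4 := Real.rpow_le_rpow (by positivity) (h3.trans (le_max_left _ 0))
    (show 0 ≤ 1 / q by positivity)
  rwa [← Real.rpow_mul (abs_nonneg _), mul_one_div_cancel hq0.ne', Real.rpow_one] at h4

/-- Near zero, `|t|^q` dominates every linear function, so that every number is a regular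
subgradient of it there. -/
lemma eventually_mul_le_abs_rpow (hlam : 0 < lam) (hq1 : q < 1) (a : ℝ) :
    ∀ᶠ t in 𝓝 (0 : ℝ), a * t ≤ lam * |t| ^ q := by
  have h1 : Tendsto (fun t : ℝ => |a| * |t| ^ (1 - q)) (𝓝 0) (𝓝 0) := by
    have : Continuous fun t : ℝ => |a| * |t| ^ (1 - q) :=
      continuous_const.mul (continuous_abs.rpow_const fun _ => Or.inr (by linarith))
    have h := this.tendsto 0
    rwa [abs_zero, Real.zero_rpow (by linarith), mul_zero] at h
  filter_upwards [h1.eventually (gt_mem_nhds hlam)] with t ht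
  rcases eq_or_ne t 0 with rfl | ht0
  · rw [mul_zero]; positivity
  have h2 : 0 < |t| := abs_pos.2 ht0
  calc a * t ≤ |a| * |t| := by rw [← abs_mul]; exact le_abs_self _
    _ = |a| * |t| ^ (1 - q) * |t| ^ q := by
      rw [mul_assoc, ← Real.rpow_add h2, sub_add_cancel, Real.rpow_one]
    _ ≤ lam * |t| ^ q := by gcongr

lemma redGrad_mem_regularSubdiff (hf : ContDiff ℝ 2 f) (hlam : 0 < lam) (hq1 : q < 1)
    (hq0 : 0 < q) (x : EuclideanSpace ℝ (Fin n)) :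
    redGrad f A lam q x ∈ regularSubdiff (objective f A lam q) x := by
  intro ε hε
  have hψ : ∀ᶠ y in 𝓝 x, |smoothPart f A y - smoothPart f A x -
      inner ℝ (gradient (smoothPart f A) x) (y - x)| ≤ ε / 2 * ‖y - x‖ := by
    have h := ((contDiff_smoothPart hf A).differentiable (by norm_num) x).hasGradientAt
    exact (hasGradientAt_iff_isLittleO.1 h).def (by positivity)
  -- the coordinates can be treated separately
  have hcoord : ∀ᶠ y in 𝓝 x, ∀ i, -(ε / (2 * (n + 1)) * |y i - x i|) ≤
      lam * |y i| ^ q - lam * |x i| ^ q +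
        (gradient (smoothPart f A) x i - redGrad f A lam q x i) * (y i - x i) := by
    refine eventually_all.2 fun i => ?_
    have hcont : Tendsto (fun y : EuclideanSpace ℝ (Fin n) => y i) (𝓝 x) (𝓝 (x i)) :=
      (by fun_prop : Continuous fun y : EuclideanSpace ℝ (Fin n) => y i).tendsto x
    rcases eq_or_ne (x i) 0 with h0 | h0
    · rw [h0] at hcont
      filter_upwards [hcont.eventually (eventually_mul_le_abs_rpow hlam hq1
        (-gradient (smoothPart f A) x i))] with y hy
      rw [redGrad_of_eq_zero h0, h0, abs_zero, Real.zero_rpow hq0.ne']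
      have : 0 ≤ ε / (2 * (n + 1)) * |y i - 0| := by positivity
      linarith
    · have hd := ((hasDerivAt_abs_rpow_of_ne q h0).const_mul lam)
      have := (hasDerivAt_iff_isLittleO.1 hd).def (show 0 < ε / (2 * (n + 1)) by positivity)
      filter_upwards [hcont.eventually this] with y hy
      rw [redGrad_of_ne_zero h0]
      rw [Real.norm_eq_abs, Real.norm_eq_abs, smul_eq_mul] at hy
      have := (abs_le.1 hy).1
      linarith
  filter_upwards [hψ, hcoord] with y hy1 hy2
  have h1 := (abs_le.1 hy1).1
  have h2 : ∑ i : Fin n, -(ε / (2 * (n + 1)) * |y i - x i|) ≤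
      lam * lqPow q y - lam * lqPow q x +
        inner ℝ (gradient (smoothPart f A) x - redGrad f A lam q x) (y - x) := by
    refine (Finset.sum_le_sum fun i _ => hy2 i).trans (le_of_eq ?_)
    rw [Finset.sum_add_distrib, Finset.sum_sub_distrib, ← Finset.mul_sum, ← Finset.mul_sum,
      PiLp.inner_apply]
    unfold lqPow
    congr 1
    exact Finset.sum_congr rfl fun i _ => by simp [mul_comm]
  have h3 : ∑ i : Fin n, ε / (2 * (n + 1)) * |y i - x i| ≤ ε / 2 * ‖y - x‖ := by
    calc _ ≤ ∑ i : Fin n, ε / (2 * (n + 1)) * ‖y - x‖ := by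
          refine Finset.sum_le_sum fun i _ => ?_
          gcongr
          exact PiLp.norm_apply_le (y - x) i
      _ = (n / (n + 1)) * (ε / 2 * ‖y - x‖) := by
          rw [Finset.sum_const, Finset.card_univ, Fintype.card_fin, nsmul_eq_mul]; field_simp
      _ ≤ 1 * (ε / 2 * ‖y - x‖) := by
          gcongr
          rw [div_le_one (by positivity)]; linarith
      _ = _ := one_mul _
  rw [Finset.sum_neg_distrib, inner_sub_left] at h2
  unfold objective
  linarith

lemma redGrad_mem_limitingSubdiff (hf : ContDiff ℝ 2 f) (hlam : 0 < lam) (hq1 : q < 1)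
    (hq0 : 0 < q) (x : EuclideanSpace ℝ (Fin n)) :
    redGrad f A lam q x ∈ limitingSubdiff (objective f A lam q) x :=
  regularSubdiff_subset_limitingSubdiff _ _ (redGrad_mem_regularSubdiff hf hlam hq1 hq0 x)

lemma sign_eq_zero_congr {x y : EuclideanSpace ℝ (Fin n)}
    (hs : ∀ i, SignType.sign (x i) = SignType.sign (y i)) (i : Fin n) : x i = 0 ↔ y i = 0 := by
  rw [← sign_eq_zero_iff, hs i, sign_eq_zero_iff]

/-- On points with the same signs whose nonzero entries are bounded away from zero, the reduced
gradient is Lipschitz continuous. -/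
lemma exists_redGrad_lipschitz (hf : ContDiff ℝ 2 f) (hlam : 0 < lam) (hq0 : 0 < q) (hq1 : q < 1)
    (A : Matrix (Fin m) (Fin n) ℝ) (B : ℝ) {ν : ℝ} (hν : 0 < ν) :
    ∃ M : ℝ, 0 < M ∧ ∀ x y : EuclideanSpace ℝ (Fin n), ‖x‖ ≤ B → ‖y‖ ≤ B →
      (∀ i, SignType.sign (x i) = SignType.sign (y i)) → (∀ i, x i ≠ 0 → ν ≤ |x i|) →
      (∀ i, y i ≠ 0 → ν ≤ |y i|) →
      ‖redGrad f A lam q x - redGrad f A lam q y‖ ≤ M * ‖x - y‖ := by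
  obtain ⟨L, hL, hlip⟩ := exists_gradient_lipschitz_of_norm_le (contDiff_smoothPart hf A) B
  obtain ⟨K, hK, hpow⟩ := exists_powDeriv_lipschitz hq0 hq1 hν
  refine ⟨(√n + 1) * (L + lam * K), by positivity, fun x y hx hy hs hνx hνy => ?_⟩
  have hi : ∀ i, |redGrad f A lam q x i - redGrad f A lam q y i| ≤
      (L + lam * K) * ‖x - y‖ := by
    intro i
    have hxy : |x i - y i| ≤ ‖x - y‖ := PiLp.norm_apply_le (x - y) i
    rcases eq_or_ne (x i) 0 with h0 | h0
    · rw [redGrad_of_eq_zero h0, redGrad_of_eq_zero ((sign_eq_zero_congr hs i).1 h0), sub_zero,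
        abs_zero]
      positivity
    · have h0' : y i ≠ 0 := fun h => h0 ((sign_eq_zero_congr hs i).2 h)
      rw [redGrad_of_ne_zero h0, redGrad_of_ne_zero h0']
      have h1 : |gradient (smoothPart f A) x i - gradient (smoothPart f A) y i| ≤ L * ‖x - y‖ :=
        (PiLp.norm_apply_le (gradient (smoothPart f A) x - gradient (smoothPart f A) y) i).trans
          (hlip x y hx hy)
      have h2 := hpow _ _ (hs i) (hνx i h0) (hνy i h0')
      calc _ = |(gradient (smoothPart f A) x i - gradient (smoothPart f A) y i) +
            lam * (powDeriv q (x i) - powDeriv q (y i))| := by ring_nf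
        _ ≤ L * ‖x - y‖ + lam * (K * ‖x - y‖) := by
          refine (abs_add_le _ _).trans (add_le_add h1 ?_)
          rw [abs_mul, abs_of_pos hlam]
          gcongr
          exact h2.trans (by gcongr)
        _ = _ := by ring
  have h1 := norm_le_mul_of_forall_abs_le (x := redGrad f A lam q x - redGrad f A lam q y)
    (by positivity) hi
  refine h1.trans ?_
  have : 0 ≤ (L + lam * K) * ‖x - y‖ := by positivity
  linarith

/-- The objective is differentiable along the coordinate directions of the support. -/
lemma hasDerivAt_objective_line (hf : ContDiff ℝ 2 f) (hq0 : 0 < q)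
    {x d : EuclideanSpace ℝ (Fin n)} {s : ℝ} (hd : ∀ i, (x + s • d) i = 0 → x i = 0 ∧ d i = 0) :
    HasDerivAt (fun s : ℝ => objective f A lam q (x + s • d))
      (inner ℝ (redGrad f A lam q (x + s • d)) d) s := by
  have hline : HasDerivAt (fun s : ℝ => x + s • d) d s := by
    simpa using ((hasDerivAt_id s).smul_const d).const_add x
  have h1 := ((contDiff_smoothPart hf A).differentiable (by norm_num)
    (x + s • d)).hasGradientAt.hasFDerivAt.comp_hasDerivAt s hline
  rw [InnerProductSpace.toDual_apply_apply] at h1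
  have h2 : HasDerivAt (fun s : ℝ => lqPow q (x + s • d))
      (∑ i, if (x + s • d) i = 0 then 0 else powDeriv q ((x + s • d) i) * d i) s := by
    unfold lqPow
    refine HasDerivAt.fun_sum fun i _ => ?_
    split_ifs with h0
    · obtain ⟨hx, hd⟩ := hd i h0
      simp [hx, hd, Real.zero_rpow hq0.ne', hasDerivAt_const]
    · have hli : HasDerivAt (fun s : ℝ => (x + s • d) i) (d i) s := by
        simpa using ((hasDerivAt_id s).mul_const (d i)).const_add (x i)
      exact (hasDerivAt_abs_rpow_of_ne q h0).comp s hli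
  refine (h1.add (h2.const_mul lam)).congr_deriv ?_
  rw [PiLp.inner_apply, PiLp.inner_apply, Finset.mul_sum, ← Finset.sum_add_distrib]
  refine Finset.sum_congr rfl fun i _ => ?_
  split_ifs with h0
  · simp [(hd i h0).2]
  · simp only [redGrad_of_ne_zero h0, RCLike.inner_apply, conj_trivial]
    ring

/-- A perturbation within the support by at most half of the lower bound `ν` of the nonzero entries
changes no sign and keeps the nonzero entries above `ν / 2`. -/
lemma add_same_sign {x v : EuclideanSpace ℝ (Fin n)} {ν : ℝ}
    (hx : ∀ i, x i ≠ 0 → ν ≤ |x i|) (hv : ∀ i, x i = 0 → v i = 0) (hvν : ‖v‖ ≤ ν / 2) (i : Fin n) :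
    SignType.sign ((x + v) i) = SignType.sign (x i) ∧
      ((x + v) i ≠ 0 → ν / 2 ≤ |(x + v) i|) := by
  have hvi : |v i| ≤ ν / 2 := (PiLp.norm_apply_le v i).trans hvν
  have hadd : (x + v) i = x i + v i := rfl
  rw [hadd]
  obtain ⟨h1, h2⟩ := abs_le.1 hvi
  rcases lt_trichotomy (x i) 0 with h | h | h
  · have h3 := hx i h.ne
    rw [abs_of_neg h] at h3
    rw [sign_neg h, sign_neg (by linarith : x i + v i < 0)]
    exact ⟨rfl, fun _ => by rw [abs_of_neg (by linarith)]; linarith⟩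
  · simp [h, hv i h]
  · have h3 := hx i h.ne'
    rw [abs_of_pos h] at h3
    rw [sign_pos h, sign_pos (by linarith : 0 < x i + v i)]
    exact ⟨rfl, fun _ => by rw [abs_of_pos (by linarith)]; linarith⟩

/-- The upper quadratic bound for the objective along a direction in the support, valid as long as
the step does not exceed half of the smallest nonzero entry. -/
lemma exists_objective_line_le (hf : ContDiff ℝ 2 f) (hlam : 0 < lam) (hq0 : 0 < q) (hq1 : q < 1)
    (A : Matrix (Fin m) (Fin n) ℝ) (B : ℝ) {ν : ℝ} (hν : 0 < ν) :
    ∃ M : ℝ, 0 < M ∧ ∀ x d : EuclideanSpace ℝ (Fin n), ∀ t : ℝ, ‖x‖ ≤ B →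
      (∀ i, x i ≠ 0 → ν ≤ |x i|) → (∀ i, x i = 0 → d i = 0) → 0 ≤ t → ‖t • d‖ ≤ ν / 2 →
      ‖redGrad f A lam q (x + t • d) - redGrad f A lam q x‖ ≤ M * ‖t • d‖ ∧
      objective f A lam q (x + t • d) ≤
        objective f A lam q x + t * inner ℝ (redGrad f A lam q x) d + M * t ^ 2 * ‖d‖ ^ 2 := by
  obtain ⟨M, hM, hlip⟩ := exists_redGrad_lipschitz hf hlam hq0 hq1 A (B + ν / 2) (half_pos hν)
  refine ⟨M, hM, fun x d t hx hxν hd ht htd => ?_⟩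
  have hs : ∀ s ∈ Set.Icc 0 t, ‖s • d‖ ≤ ν / 2 := by
    intro s hs
    refine le_trans ?_ htd
    rw [norm_smul, norm_smul, Real.norm_of_nonneg hs.1, Real.norm_of_nonneg ht]
    gcongr
    exact hs.2
  have hv : ∀ s : ℝ, ∀ i, x i = 0 → (s • d) i = 0 := fun s i hi => by simp [hd i hi]
  have hsame : ∀ s ∈ Set.Icc 0 t, _ := fun s hs' => add_same_sign hxν (hv s) (hs s hs')
  have hgrad : ∀ s ∈ Set.Icc 0 t,
      ‖redGrad f A lam q (x + s • d) - redGrad f A lam q x‖ ≤ M * ‖s • d‖ := by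
    intro s hs'
    have := hlip (x + s • d) x ((norm_add_le _ _).trans (add_le_add hx (hs s hs')))
      (by linarith) (fun i => (hsame s hs' i).1) (fun i => (hsame s hs' i).2)
      (fun i hi => by linarith [hxν i hi])
    simpa using this
  refine ⟨hgrad t ⟨ht, le_rfl⟩, le_add_of_lipschitz_line ht (fun s hs' => ?_) hgrad hM.le⟩
  refine hasDerivAt_objective_line hf hq0 fun i hi => ?_
  have h0 := (sign_eq_zero_congr (fun i => (hsame s hs' i).1) i).1 hi
  exact ⟨h0, hd i h0⟩

end Objective

/-! ### Proximal gradient points -/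

section Prox

variable {m n : ℕ} {f : EuclideanSpace ℝ (Fin m) → ℝ} {A : Matrix (Fin m) (Fin n) ℝ} {lam q : ℝ}

lemma powDeriv_mul_self (q : ℝ) {t : ℝ} (ht : t ≠ 0) : powDeriv q t * t = q * |t| ^ q := by
  have h1 : 0 < |t| := abs_pos.2 ht
  have h2 : ((SignType.sign t : SignType) : ℝ) * t = |t| := sign_mul_self t
  rw [powDeriv, mul_assoc, h2, mul_assoc, ← Real.rpow_add_one h1.ne', sub_add_cancel]

/-- A proximal gradient point minimizes the linearized objective plus a quadratic term. -/
lemma mem_proxGrad_iff {μ : ℝ} (hμ : 0 < μ) {x z : EuclideanSpace ℝ (Fin n)} :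
    z ∈ proxGrad f A lam q μ x ↔ ∀ w,
      inner ℝ (gradient (smoothPart f A) x) (z - x) + μ / 2 * ‖z - x‖ ^ 2 + lam * lqPow q z ≤
      inner ℝ (gradient (smoothPart f A) x) (w - x) + μ / 2 * ‖w - x‖ ^ 2 + lam * lqPow q w := by
  have key : ∀ w, 1 / (2 * μ⁻¹) * ‖w - (x - μ⁻¹ • gradient (smoothPart f A) x)‖ ^ 2 =
      inner ℝ (gradient (smoothPart f A) x) (w - x) + μ / 2 * ‖w - x‖ ^ 2 +
        μ⁻¹ / 2 * ‖gradient (smoothPart f A) x‖ ^ 2 := by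
    intro w
    rw [← sub_add, norm_add_sq_real, norm_smul, inner_smul_right, real_inner_comm, mul_pow,
      Real.norm_eq_abs, sq_abs]
    field_simp
    ring
  unfold proxGrad prox
  refine forall_congr' fun w => ?_
  rw [key z, key w]
  constructor <;> intro h <;> linarith

lemma proxGrad_coord {μ : ℝ} (hμ : 0 < μ) {x z : EuclideanSpace ℝ (Fin n)}
    (hz : z ∈ proxGrad f A lam q μ x) (i : Fin n) (t : ℝ) :
    gradient (smoothPart f A) x i * (z i - x i) + μ / 2 * (z i - x i) ^ 2 + lam * |z i| ^ q ≤
      gradient (smoothPart f A) x i * (t - x i) + μ / 2 * (t - x i) ^ 2 + lam * |t| ^ q := by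
  set g := gradient (smoothPart f A) x
  have hsum : ∀ w : EuclideanSpace ℝ (Fin n),
      inner ℝ g (w - x) + μ / 2 * ‖w - x‖ ^ 2 + lam * lqPow q w =
        ∑ j, (g j * (w j - x j) + μ / 2 * (w j - x j) ^ 2 + lam * |w j| ^ q) := by
    intro w
    rw [Finset.sum_add_distrib, Finset.sum_add_distrib, ← Finset.mul_sum, ← Finset.mul_sum,
      EuclideanSpace.real_norm_sq_eq, PiLp.inner_apply]
    simp [lqPow, mul_comm]
  have h := (mem_proxGrad_iff hμ).1 hz (WithLp.toLp 2 (Function.update z.ofLp i t))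
  rw [hsum, hsum, ← Finset.add_sum_erase _ _ (Finset.mem_univ i),
    ← Finset.add_sum_erase _ _ (Finset.mem_univ i)] at h
  have h2 : ∀ j ∈ Finset.univ.erase i, (WithLp.toLp 2 (Function.update z.ofLp i t) :
      EuclideanSpace ℝ (Fin n)) j = z j := fun j hj => by
    simp [Function.update_of_ne (Finset.ne_of_mem_erase hj)]
  have h3 : (WithLp.toLp 2 (Function.update z.ofLp i t) : EuclideanSpace ℝ (Fin n)) i = t := by
    simp
  rw [h3] at h
  have h4 : ∑ j ∈ Finset.univ.erase i, (g j * (z j - x j) + μ / 2 * (z j - x j) ^ 2 +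
      lam * |z j| ^ q) = _ := Finset.sum_congr rfl fun j hj => by rw [← h2 j hj]
  rw [h4] at h
  exact le_of_add_le_add_right h

lemma proxGrad_first_order {μ : ℝ} (hμ : 0 < μ) {x z : EuclideanSpace ℝ (Fin n)}
    (hz : z ∈ proxGrad f A lam q μ x) {i : Fin n} (hi : z i ≠ 0) :
    gradient (smoothPart f A) x i + μ * (z i - x i) + lam * powDeriv q (z i) = 0 := by
  set g := gradient (smoothPart f A) x
  have hmin : IsLocalMin (fun t => g i * (t - x i) + μ / 2 * (t - x i) ^ 2 + lam * |t| ^ q) (z i) :=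
    Eventually.of_forall fun t => proxGrad_coord hμ hz i t
  have h1 : HasDerivAt (fun t : ℝ => t - x i) 1 (z i) := (hasDerivAt_id _).sub_const _
  have hd := ((h1.const_mul (g i)).add ((h1.pow 2).const_mul (μ / 2))).add
    ((hasDerivAt_abs_rpow_of_ne q hi).const_mul lam)
  have := hmin.hasDerivAt_eq_zero hd
  simp only [Nat.cast_ofNat] at this
  linarith

/-- Comparing a nonzero entry of a proximal gradient point with zero, and eliminating the gradient
by the first-order condition, bounds the entry from below. -/
lemma proxGrad_lower_bound (hlam : 0 < lam) (hq0 : 0 < q) (hq1 : q < 1) {μ : ℝ} (hμ : 0 < μ)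
    {x z : EuclideanSpace ℝ (Fin n)} (hz : z ∈ proxGrad f A lam q μ x) {i : Fin n} (hi : z i ≠ 0) :
    lam * q * (1 - q) * |z i| ^ (q - 2) ≤ μ := by
  have h1 := proxGrad_coord hμ hz i 0
  have h2 := proxGrad_first_order hμ hz hi
  have h3 := powDeriv_mul_self q hi
  rw [abs_zero, Real.zero_rpow hq0.ne', mul_zero, add_zero] at h1
  have hz0 : 0 < |z i| := abs_pos.2 hi
  have h4 : lam * (1 - q) * |z i| ^ q ≤ μ / 2 * |z i| ^ 2 := by
    rw [sq_abs]
    have h5 : gradient (smoothPart f A) x i * z i + μ * (z i - x i) * z i +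
        lam * (powDeriv q (z i) * z i) = 0 := by
      linear_combination z i * h2
    rw [h3] at h5
    linarith
  have h5 : |z i| ^ q = |z i| ^ (q - 2) * |z i| ^ 2 := by
    rw [← Real.rpow_natCast, ← Real.rpow_add hz0]; norm_num
  rw [h5, ← mul_assoc] at h4
  have h6 := le_of_mul_le_mul_right h4 (by positivity)
  have h7 : 0 ≤ lam * (1 - q) * |z i| ^ (q - 2) := by have := sub_pos.2 hq1; positivity
  nlinarith

lemma rpow_le_of_mul_rpow_le {c μ t : ℝ} (hc : 0 < c) (hμ : 0 < μ) (ht : 0 < t) (hq1 : q < 1)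
    (h : c * t ^ (q - 2) ≤ μ) : (c / μ) ^ (1 / (2 - q)) ≤ t := by
  have h1 : c / μ ≤ t ^ (2 - q) := by
    rw [div_le_iff₀ hμ]
    calc c = t ^ (2 - q) * (c * t ^ (q - 2)) := by
          rw [mul_left_comm, ← Real.rpow_add ht]; simp
      _ ≤ t ^ (2 - q) * μ := by gcongr
  have h2 := Real.rpow_le_rpow (by positivity) h1
    (show 0 ≤ 1 / (2 - q) from one_div_nonneg.2 (by linarith))
  rwa [← Real.rpow_mul ht.le, mul_one_div_cancel (by linarith), Real.rpow_one] at h2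

lemma absMin_le {x : EuclideanSpace ℝ (Fin n)} {i : Fin n} (hi : x i ≠ 0) : absMin x ≤ |x i| :=
  csInf_le ⟨0, by rintro _ ⟨j, -, rfl⟩; exact abs_nonneg _⟩ ⟨i, hi, rfl⟩

lemma exists_absMin_eq {x : EuclideanSpace ℝ (Fin n)} (hx : x ≠ 0) :
    ∃ i, x i ≠ 0 ∧ absMin x = |x i| := by
  have hne : ((fun i => |x i|) '' {i | x i ≠ 0}).Nonempty := by
    by_contra h
    refine hx (PiLp.ext fun i => ?_)
    by_contra hi
    exact h ⟨_, i, hi, rfl⟩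
  obtain ⟨i, hi, h⟩ := hne.csInf_mem (Set.toFinite _)
  exact ⟨i, hi, h.symm⟩

/-- The switching condition transfers the lower bound for the nonzero entries from the proximal
gradient point to the iterate. -/
lemma SwitchCond.lower_bound (hlam : 0 < lam) (hq0 : 0 < q) (hq1 : q < 1) {μ : ℝ} (hμ : 0 < μ)
    {x z : EuclideanSpace ℝ (Fin n)} (hz : z ∈ proxGrad f A lam q μ x)
    (hs : SwitchCond lam q μ x z) {i : Fin n} (hi : x i ≠ 0) :
    lam * q * (1 - q) * |x i| ^ (q - 2) ≤ μ := by
  have hx0 : x ≠ 0 := fun h => hi (by simp [h])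
  have hz0 : z ≠ 0 := fun h => hi ((sign_eq_zero_congr hs.1 i).2 (by simp [h]))
  obtain ⟨j, hj, hj'⟩ := exists_absMin_eq hz0
  obtain ⟨k, hk, hk'⟩ := exists_absMin_eq hx0
  have h1 := proxGrad_lower_bound hlam hq0 hq1 hμ hz hj
  have h2 := hs.2
  rw [hj'] at h2
  have h3 : |x i| ^ (q - 2) ≤ absMin x ^ (q - 2) :=
    Real.rpow_le_rpow_of_nonpos (by rw [hk']; exact abs_pos.2 hk) (absMin_le hi) (by linarith)
  have h4 : lam * q * (1 - q) * |x i| ^ (q - 2) ≤ lam * q * (1 - q) * absMin x ^ (q - 2) := by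
    have := sub_pos.2 hq1
    gcongr
  linarith

/-- The subgradient at a proximal gradient point is bounded by the length of the step. -/
lemma norm_redGrad_proxGrad_le {μ : ℝ} (hμ : 0 < μ) {x z : EuclideanSpace ℝ (Fin n)}
    (hz : z ∈ proxGrad f A lam q μ x) :
    ‖redGrad f A lam q z‖ ≤
      ‖gradient (smoothPart f A) z - gradient (smoothPart f A) x‖ + μ * ‖z - x‖ := by
  calc _ ≤ ‖(gradient (smoothPart f A) z - gradient (smoothPart f A) x) - μ • (z - x)‖ := by
        refine norm_le_of_forall_abs_le fun i => ?_
        rcases eq_or_ne (z i) 0 with h0 | h0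
        · rw [redGrad_of_eq_zero h0, abs_zero]; exact abs_nonneg _
        · have := proxGrad_first_order hμ hz h0
          rw [redGrad_of_ne_zero h0]
          simp only [PiLp.sub_apply, PiLp.smul_apply, smul_eq_mul]
          exact le_of_eq (congrArg _ (by linarith))
    _ ≤ _ := (norm_sub_le _ _).trans (by rw [norm_smul, Real.norm_of_nonneg hμ.le])

lemma exists_norm_proxGrad_le (hf : ContDiff ℝ 2 f) (hlam : 0 < lam) (hq0 : 0 < q)
    (A : Matrix (Fin m) (Fin n) ℝ) (B : ℝ) {μ₀ : ℝ} (hμ₀ : 0 < μ₀) :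
    ∃ B' : ℝ, B ≤ B' ∧ ∀ x z μ, ‖x‖ ≤ B → μ₀ ≤ μ → z ∈ proxGrad f A lam q μ x → ‖z‖ ≤ B' := by
  have hcomp := isCompact_closedBall (0 : EuclideanSpace ℝ (Fin n)) B
  obtain ⟨a, ha⟩ := hcomp.exists_bound_of_continuousOn (continuous_lqPow hq0).continuousOn
  obtain ⟨b, hb⟩ := hcomp.exists_bound_of_continuousOn
    (contDiff_smoothPart hf A).gradient.continuous.continuousOn
  refine ⟨B + (1 + 2 * (lam * |a| + |b|) / μ₀), by
    have : 0 ≤ 2 * (lam * |a| + |b|) / μ₀ := by positivity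
    linarith, fun x z μ hx hμ hz => ?_⟩
  have hx' : x ∈ Metric.closedBall (0 : EuclideanSpace ℝ (Fin n)) B := by simpa using hx
  have h1 := (mem_proxGrad_iff (hμ₀.trans_le hμ)).1 hz x
  simp only [sub_self, inner_zero_right, norm_zero] at h1
  have h2 := (le_abs_self _).trans ((ha x hx').trans (le_abs_self a))
  have h3 := (hb x hx').trans (le_abs_self b)
  have h4 := abs_real_inner_le_norm (gradient (smoothPart f A) x) (z - x)
  have h5 := (abs_le.1 h4).1
  have h6 := mul_nonneg hlam.le (lqPow_nonneg q z)
  have h7 : ‖z - x‖ ≤ 1 + 2 * (lam * |a| + |b|) / μ₀ := by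
    have hs := norm_nonneg (z - x)
    rcases le_or_gt ‖z - x‖ 1 with h | h
    · have : 0 ≤ 2 * (lam * |a| + |b|) / μ₀ := by positivity
      linarith
    · have h8 : ‖z - x‖ ≤ 2 * (lam * |a| + |b|) / μ₀ := by
        rw [le_div_iff₀ hμ₀]
        have h9 : μ₀ / 2 * ‖z - x‖ ^ 2 ≤ lam * |a| + |b| * ‖z - x‖ := by
          have h10 : μ₀ / 2 * ‖z - x‖ ^ 2 ≤ μ / 2 * ‖z - x‖ ^ 2 := by gcongr
          have h11 : lam * lqPow q x ≤ lam * |a| := by gcongr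
          have h12 : ‖gradient (smoothPart f A) x‖ * ‖z - x‖ ≤ |b| * ‖z - x‖ := by gcongr
          linarith
        have h13 : lam * |a| ≤ lam * |a| * ‖z - x‖ :=
          le_mul_of_one_le_right (by positivity) h.le
        have h14 : (μ₀ / 2 * ‖z - x‖) * ‖z - x‖ ≤ (lam * |a| + |b|) * ‖z - x‖ := by
          linarith
        have := le_of_mul_le_mul_right h14 (by linarith)
        linarith
      linarith
  have := norm_add_le x (z - x)
  rw [add_sub_cancel] at this
  linarith

/-- The line search accepts as soon as `μ ≥ 2 L + α`, where `L` is a Lipschitz constant of the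
gradient of the smooth part; hence the accepted step-sizes stay bounded. -/
lemma exists_stepsize_le (hf : ContDiff ℝ 2 f) (hlam : 0 < lam) (hq0 : 0 < q)
    (A : Matrix (Fin m) (Fin n) ℝ) (P : Params) (B : ℝ) :
    ∃ μmax : ℝ, 0 < μmax ∧ ∀ x z μ μ', ‖x‖ ≤ B → μ ∈ Set.Icc P.μmin P.μmax →
      IsPGOutput f A lam q P.τ P.α x μ z μ' → μ' ≤ μmax := by
  obtain ⟨B', hBB', hB'⟩ := exists_norm_proxGrad_le hf hlam hq0 A B P.μmin_pos
  obtain ⟨L, hL, hlip⟩ := exists_gradient_lipschitz_of_norm_le (contDiff_smoothPart hf A) B'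
  have hτ := P.one_lt_τ
  have hα := P.α_pos
  refine ⟨max P.μmax (P.τ * (2 * L + P.α)), lt_max_of_lt_right (by positivity), ?_⟩
  rintro x z μ μ' hx hμ ⟨l, y, hy, hrej, -, -, rfl⟩
  have hμ0 : 0 < μ := P.μmin_pos.trans_le hμ.1
  rcases l with _ | l
  · rw [pow_zero, one_mul]; exact hμ.2.trans (le_max_left _ _)
  refine le_max_of_le_right ?_
  have hpos : P.μmin ≤ P.τ ^ l * μ :=
    hμ.1.trans (le_mul_of_one_le_left hμ0.le (one_le_pow₀ hτ.le))
  have hyl := hy l (by omega)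
  have h1 := hrej l (by omega)
  have h2 := (mem_proxGrad_iff (P.μmin_pos.trans_le hpos)).1 hyl x
  simp only [sub_self, inner_zero_right, norm_zero] at h2
  have h3 := le_add_of_gradient_lipschitz ((contDiff_smoothPart hf A).differentiable (by norm_num))
    hL.le hlip (hx.trans hBB') (hB' x _ _ hx hpos hyl)
  unfold objective at h1
  have h4 : P.τ ^ l * μ < 2 * L + P.α := by
    by_contra! h5
    have := mul_le_mul_of_nonneg_right h5 (sq_nonneg ‖y l - x‖)
    linarith
  calc P.τ ^ (l + 1) * μ = P.τ * (P.τ ^ l * μ) := by ring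
    _ ≤ _ := by gcongr

lemma IsPGOutput.spec {P : Params} {x z : EuclideanSpace ℝ (Fin n)} {μ μ' : ℝ}
    (hμ : μ ∈ Set.Icc P.μmin P.μmax) (h : IsPGOutput f A lam q P.τ P.α x μ z μ') :
    z ∈ proxGrad f A lam q μ' x ∧ P.μmin ≤ μ' ∧
      objective f A lam q z ≤ objective f A lam q x - P.α / 2 * ‖z - x‖ ^ 2 := by
  obtain ⟨l, y, hy, -, hacc, rfl, rfl⟩ := h
  exact ⟨hy l le_rfl, hμ.1.trans (le_mul_of_one_le_left (P.μmin_pos.le.trans hμ.1)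
    (one_le_pow₀ P.one_lt_τ.le)), hacc⟩

lemma proxGrad_closed (hf : ContDiff ℝ 2 f) (hq0 : 0 < q) {x z : ℕ → EuclideanSpace ℝ (Fin n)}
    {μ : ℕ → ℝ} {x₀ z₀ : EuclideanSpace ℝ (Fin n)} {μ₀ : ℝ} (hx : Tendsto x atTop (𝓝 x₀))
    (hz : Tendsto z atTop (𝓝 z₀)) (hμ : Tendsto μ atTop (𝓝 μ₀)) (hμ₀ : 0 < μ₀)
    (hmem : ∀ k, z k ∈ proxGrad f A lam q (μ k) (x k)) : z₀ ∈ proxGrad f A lam q μ₀ x₀ := by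
  refine (mem_proxGrad_iff hμ₀).2 fun w => ?_
  have hg : Tendsto (fun k => gradient (smoothPart f A) (x k)) atTop
      (𝓝 (gradient (smoothPart f A) x₀)) :=
    ((contDiff_smoothPart hf A).gradient.continuous.tendsto x₀).comp hx
  have hlq : Tendsto (fun k => lqPow q (z k)) atTop (𝓝 (lqPow q z₀)) :=
    ((continuous_lqPow hq0).tendsto z₀).comp hz
  refine le_of_tendsto_of_tendsto
    (((hg.inner (hz.sub hx)).add ((hμ.div_const 2).mul ((hz.sub hx).norm.pow 2))).add
      (hlq.const_mul lam))
    (((hg.inner (tendsto_const_nhds.sub hx)).add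
      ((hμ.div_const 2).mul ((tendsto_const_nhds.sub hx).norm.pow 2))).add
      tendsto_const_nhds) ?_
  filter_upwards [hμ.eventually (lt_mem_nhds hμ₀)] with k hk
  exact (mem_proxGrad_iff hk).1 (hmem k) w

/-- The derivative of `μ / 2 * t ^ 2 + lam * |t| ^ q` is strictly convex on `(0, ∞)`, so that it
takes no value twice on the set where the second derivative is nonnegative. -/
lemma eq_of_critical_of_pos (hlam : 0 < lam) (hq0 : 0 < q) (hq1 : q < 1) {μ a b : ℝ} (ha : 0 < a)
    (hb : 0 < b) (ha2 : lam * q * (1 - q) * a ^ (q - 2) ≤ μ)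
    (hb2 : lam * q * (1 - q) * b ^ (q - 2) ≤ μ)
    (h : μ * a + lam * (q * a ^ (q - 1)) = μ * b + lam * (q * b ^ (q - 1))) : a = b := by
  wlog hab : a < b generalizing a b
  · rcases (not_lt.1 hab).eq_or_lt with h' | h'
    · exact h'.symm
    · exact (this hb ha hb2 ha2 h.symm h').symm
  exfalso
  have hd : ∀ t : ℝ, 0 < t → HasDerivAt (fun s : ℝ => s ^ (q - 1)) ((q - 1) * t ^ (q - 1 - 1)) t :=
    fun t ht => Real.hasDerivAt_rpow_const (Or.inl ht.ne')
  obtain ⟨s, hs, hs'⟩ := exists_hasDerivAt_eq_slope (fun s : ℝ => s ^ (q - 1)) _ hab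
    (fun t ht => (hd t (ha.trans_le ht.1)).continuousAt.continuousWithinAt)
    (fun t ht => hd t (ha.trans ht.1))
  rw [eq_div_iff (by linarith), show q - 1 - 1 = q - 2 by ring] at hs'
  have h1 : s ^ (q - 2) < a ^ (q - 2) := Real.rpow_lt_rpow_of_neg ha hs.1 (by linarith)
  have h2 : lam * q * (1 - q) * s ^ (q - 2) < μ := by
    refine lt_of_lt_of_le ?_ ha2
    have := sub_pos.2 hq1
    gcongr
  have h3 : (lam * q * (1 - q) * s ^ (q - 2)) * (b - a) = μ * (b - a) := by
    linear_combination (-lam * q) * hs' + h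
  have h4 := mul_right_cancel₀ (sub_pos.2 hab).ne' h3
  exact h2.ne h4

lemma eq_of_critical (hlam : 0 < lam) (hq0 : 0 < q) (hq1 : q < 1) {μ a b : ℝ}
    (hsign : SignType.sign a = SignType.sign b) (ha : a ≠ 0)
    (ha2 : lam * q * (1 - q) * |a| ^ (q - 2) ≤ μ) (hb2 : lam * q * (1 - q) * |b| ^ (q - 2) ≤ μ)
    (h : μ * a + lam * powDeriv q a = μ * b + lam * powDeriv q b) : a = b := by
  rcases ha.lt_or_gt with ha | ha
  · have hb : b < 0 := by rwa [sign_neg ha, eq_comm, sign_eq_neg_one_iff] at hsign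
    rw [powDeriv, powDeriv, sign_neg ha, sign_neg hb] at h
    have := eq_of_critical_of_pos hlam hq0 hq1 (abs_pos.2 ha.ne) (abs_pos.2 hb.ne) ha2 hb2 (by
      simp only [SignType.coe_neg_one] at h
      rw [abs_of_neg ha, abs_of_neg hb] at h ⊢
      linarith)
    rw [abs_of_neg ha, abs_of_neg hb] at this
    exact neg_injective this
  · have hb : 0 < b := by rwa [sign_pos ha, eq_comm, sign_eq_one_iff] at hsign
    rw [powDeriv, powDeriv, sign_pos ha, sign_pos hb] at h
    have := eq_of_critical_of_pos hlam hq0 hq1 (abs_pos.2 ha.ne') (abs_pos.2 hb.ne') ha2 hb2 (by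
      simp only [SignType.coe_one] at h
      rw [abs_of_pos ha, abs_of_pos hb] at h ⊢
      linarith)
    rwa [abs_of_pos ha, abs_of_pos hb] at this

end Prox

/-! ### Newton directions on the support -/

section Hessian

variable {E : Type*} [NormedAddCommGroup E] [InnerProductSpace ℝ E]

lemma hess_isSymmetric [CompleteSpace E] {h : E → ℝ} {u : E} (hh : ContDiffAt ℝ 2 h u) :
    (hess h u : E →ₗ[ℝ] E).IsSymmetric := by
  have hsymm : IsSymmSndFDerivAt ℝ h u := hh.isSymmSndFDerivAt (by simp)
  have hd : DifferentiableAt ℝ (fderiv ℝ h) u :=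
    (hh.fderiv_right (m := 1) (by norm_num)).differentiableAt one_ne_zero
  have key : ∀ v w, inner ℝ (hess h u v) w = fderiv ℝ (fderiv ℝ h) u v w := by
    intro v w
    have h1 : DifferentiableAt ℝ (gradient h) u :=
      ((InnerProductSpace.toDual ℝ E).symm.contDiff.contDiffAt.comp u
        (hh.fderiv_right (m := 1) (by norm_num))).differentiableAt one_ne_zero
    have h2 : HasFDerivAt (fun y => inner ℝ (gradient h y) w) _ u :=
      h1.hasFDerivAt.inner ℝ (hasFDerivAt_const w u)
    have h3 : HasFDerivAt (fun y => fderiv ℝ h y w) _ u :=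
      hd.hasFDerivAt.clm_apply (hasFDerivAt_const w u)
    have h4 : (fun y => inner ℝ (gradient h y) w) = fun y => fderiv ℝ h y w := by
      funext y
      exact InnerProductSpace.toDual_symm_apply
    rw [h4] at h2
    simpa [hess] using DFunLike.congr_fun (h2.unique h3) v
  intro v w
  have h2 := hsymm v w
  rw [← key, ← key] at h2
  exact h2.trans (real_inner_comm _ _)

lemma lambdaMin_mul_le [FiniteDimensional ℝ E] {T : E →L[ℝ] E}
    (hT : (T : E →ₗ[ℝ] E).IsSymmetric) (v : E) : lambdaMin T * ‖v‖ ^ 2 ≤ inner ℝ (T v) v := by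
  set b := hT.eigenvectorBasis rfl
  have hfin : {t : ℝ | Module.End.HasEigenvalue (T : E →ₗ[ℝ] E) t}.Finite :=
    Module.End.finite_hasEigenvalue _
  have hle : ∀ i, lambdaMin T ≤ hT.eigenvalues rfl i := fun i =>
    csInf_le hfin.bddBelow (hT.hasEigenvalue_eigenvalues rfl i)
  have h1 : inner ℝ (T v) v = ∑ i, hT.eigenvalues rfl i * (b.repr v i) ^ 2 := by
    rw [← b.repr.inner_map_map, PiLp.inner_apply]
    refine Finset.sum_congr rfl fun i _ => ?_
    have := hT.eigenvectorBasis_apply_self_apply rfl v i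
    rw [ContinuousLinearMap.coe_coe] at this
    simp only [b, this, RCLike.inner_apply, conj_trivial, RCLike.ofReal_real_eq_id, id]
    ring
  rw [h1, ← b.repr.norm_map v, EuclideanSpace.real_norm_sq_eq, Finset.mul_sum]
  exact Finset.sum_le_sum fun i _ => by gcongr; exact hle i

lemma neg_lambdaMin_le (T : E →L[ℝ] E) : -lambdaMin T ≤ ‖T‖ := by
  unfold lambdaMin
  rcases Set.eq_empty_or_nonempty {t : ℝ | Module.End.HasEigenvalue (T : E →ₗ[ℝ] E) t} with h | h
  · rw [h, Real.sInf_empty, neg_zero]; exact norm_nonneg T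
  refine neg_le.1 (le_csInf h fun t ht => ?_)
  obtain ⟨v, hv⟩ := ht.exists_hasEigenvector
  have h1 : T v = t • v := hv.apply_eq_smul
  have h2 := T.le_opNorm v
  rw [h1, norm_smul] at h2
  have h3 := le_of_mul_le_mul_right h2 (norm_pos_iff.2 hv.2)
  rw [Real.norm_eq_abs] at h3
  exact (abs_le.1 h3).1

end Hessian

section Subspace

variable {m n : ℕ} {f : EuclideanSpace ℝ (Fin m) → ℝ} {A : Matrix (Fin m) (Fin n) ℝ} {lam q : ℝ}

/-- The extension by zero of a vector indexed by `S`. -/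
noncomputable def extZero (S : Finset (Fin n)) :
    EuclideanSpace ℝ S →ₗ[ℝ] EuclideanSpace ℝ (Fin n) where
  toFun u := WithLp.toLp 2 fun i => if h : i ∈ S then u ⟨i, h⟩ else 0
  map_add' u v := by
    ext i
    by_cases h : i ∈ S <;> simp [h]
  map_smul' c u := by
    ext i
    by_cases h : i ∈ S <;> simp [h]

lemma extZero_apply_mem {S : Finset (Fin n)} (u : EuclideanSpace ℝ S) (i : S) :
    extZero S u i = u i := by simp [extZero]

lemma extZero_apply_of_notMem {S : Finset (Fin n)} (u : EuclideanSpace ℝ S) {i : Fin n}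
    (h : i ∉ S) : extZero S u i = 0 := by simp [extZero, h]

lemma extZero_subvec {S : Finset (Fin n)} {x : EuclideanSpace ℝ (Fin n)}
    (h : ∀ i ∉ S, x i = 0) : extZero S (subvec S x) = x := by
  ext i
  by_cases hi : i ∈ S
  · exact extZero_apply_mem _ ⟨i, hi⟩
  · rw [extZero_apply_of_notMem _ hi, h i hi]

lemma sum_eq_sum_coe {S : Finset (Fin n)} {φ : Fin n → ℝ} (h : ∀ i ∉ S, φ i = 0) :
    ∑ i, φ i = ∑ i : S, φ i := by
  rw [Finset.sum_coe_sort S φ]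
  exact (Finset.sum_subset (Finset.subset_univ S) fun i _ hi => h i hi).symm

lemma inner_extZero {S : Finset (Fin n)} (u : EuclideanSpace ℝ S) (x : EuclideanSpace ℝ (Fin n)) :
    inner ℝ x (extZero S u) = inner ℝ (subvec S x) u := by
  rw [PiLp.inner_apply, PiLp.inner_apply, sum_eq_sum_coe (S := S)]
  · exact Finset.sum_congr rfl fun i _ => by rw [extZero_apply_mem]; rfl
  · intro i hi
    rw [extZero_apply_of_notMem _ hi, inner_zero_right]

lemma inner_subvec {S : Finset (Fin n)} (x : EuclideanSpace ℝ (Fin n))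
    {y : EuclideanSpace ℝ (Fin n)} (h : ∀ i ∉ S, y i = 0) :
    inner ℝ (subvec S x) (subvec S y) = inner ℝ x y := by
  rw [← inner_extZero, extZero_subvec h]

lemma norm_subvec {S : Finset (Fin n)} {x : EuclideanSpace ℝ (Fin n)} (h : ∀ i ∉ S, x i = 0) :
    ‖subvec S x‖ = ‖x‖ := by
  rw [← sq_eq_sq₀ (norm_nonneg _) (norm_nonneg _), ← real_inner_self_eq_norm_sq,
    ← real_inner_self_eq_norm_sq, inner_subvec x h]

lemma norm_subvec_le (S : Finset (Fin n)) (x : EuclideanSpace ℝ (Fin n)) :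
    ‖subvec S x‖ ≤ ‖x‖ := by
  rw [EuclideanSpace.norm_eq, EuclideanSpace.norm_eq]
  refine Real.sqrt_le_sqrt ?_
  have : ∑ i : S, ‖subvec S x i‖ ^ 2 = ∑ i ∈ S, ‖x i‖ ^ 2 :=
    Finset.sum_coe_sort S fun i => ‖x i‖ ^ 2
  rw [this]
  exact Finset.sum_le_univ_sum_of_nonneg fun i => by positivity

lemma norm_extZero {S : Finset (Fin n)} (u : EuclideanSpace ℝ S) : ‖extZero S u‖ = ‖u‖ := by
  rw [← norm_subvec (S := S) fun i hi => extZero_apply_of_notMem u hi]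
  congr 1
  ext i
  exact extZero_apply_mem u i

/-- The restricted objective is the objective composed with the extension by zero. -/
lemma subObjective_eq (hq0 : 0 < q) (S : Finset (Fin n)) (u : EuclideanSpace ℝ S) :
    subObjective f A lam q S u = objective f A lam q (extZero S u) := by
  unfold subObjective objective smoothPart lqPow
  congr 2
  · congr 1
    ext j
    change ∑ i : S, A j i * u i = ∑ i, A j i * extZero S u i
    rw [sum_eq_sum_coe (S := S) fun i hi => by rw [extZero_apply_of_notMem _ hi, mul_zero]]
    exact Finset.sum_congr rfl fun i _ => by rw [extZero_apply_mem]
  · rw [sum_eq_sum_coe (S := S) fun i hi => by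
      rw [extZero_apply_of_notMem _ hi, abs_zero, Real.zero_rpow hq0.ne']]
    exact Finset.sum_congr rfl fun i _ => by rw [extZero_apply_mem]

lemma notMem_supp {x : EuclideanSpace ℝ (Fin n)} {i : Fin n} : i ∉ supp x ↔ x i = 0 := by
  simp [supp]

lemma contDiffAt_subObjective (hf : ContDiff ℝ 2 f) {S : Finset (Fin n)} {u : EuclideanSpace ℝ S}
    (hu : ∀ i, u i ≠ 0) : ContDiffAt ℝ 2 (subObjective f A lam q S) u := by
  unfold subObjective objective lqPow
  refine (contDiff_smoothPart hf _).contDiffAt.add (contDiffAt_const.mul ?_)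
  refine ContDiffAt.sum fun i _ => ?_
  have h1 : ContDiffAt ℝ 2 (fun u : EuclideanSpace ℝ S => u i) u := by fun_prop
  have h2 : ContDiffAt ℝ 2 (fun u : EuclideanSpace ℝ S => |u i|) u :=
    ContDiffAt.comp (g := fun t : ℝ => |t|) u (contDiffAt_abs (hu i)) h1
  exact h2.rpow_const_of_ne (abs_ne_zero.2 (hu i))

lemma gradient_subObjective (hf : ContDiff ℝ 2 f) (hq0 : 0 < q) {S : Finset (Fin n)}
    {u : EuclideanSpace ℝ S} (hu : ∀ i, u i ≠ 0) :
    gradient (subObjective f A lam q S) u = subvec S (redGrad f A lam q (extZero S u)) := by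
  refine ext_inner_right ℝ fun v => ?_
  have hd : DifferentiableAt ℝ (subObjective f A lam q S) u :=
    (contDiffAt_subObjective hf hu).differentiableAt (by norm_num)
  have hline : HasDerivAt (fun s : ℝ => u + s • v) v 0 := by
    simpa using ((hasDerivAt_id (0 : ℝ)).smul_const v).const_add u
  have h0 : u + (0 : ℝ) • v = u := by simp
  have h1 := (h0.symm ▸ hd.hasGradientAt.hasFDerivAt : HasFDerivAt (subObjective f A lam q S)
    (InnerProductSpace.toDual ℝ _ (gradient (subObjective f A lam q S) u))
    (u + (0 : ℝ) • v)).comp_hasDerivAt (0 : ℝ) hline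
  have h2 : HasDerivAt (fun s : ℝ => objective f A lam q (extZero S u + s • extZero S v))
      (inner ℝ (redGrad f A lam q (extZero S u + (0 : ℝ) • extZero S v)) (extZero S v)) 0 := by
    refine hasDerivAt_objective_line hf hq0 fun i hi => ?_
    rw [zero_smul, add_zero] at hi
    by_cases hiS : i ∈ S
    · exact absurd ((extZero_apply_mem u ⟨i, hiS⟩).symm.trans hi) (hu _)
    · exact ⟨hi, extZero_apply_of_notMem _ hiS⟩
  have h3 : (fun s : ℝ => objective f A lam q (extZero S u + s • extZero S v)) =
      subObjective f A lam q S ∘ fun s : ℝ => u + s • v := by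
    funext s
    rw [Function.comp_apply, subObjective_eq hq0, map_add, map_smul]
  rw [h3, zero_smul, add_zero, inner_extZero] at h2
  rw [InnerProductSpace.toDual_apply_apply] at h1
  exact h1.unique h2

lemma subvec_supp_ne_zero (x : EuclideanSpace ℝ (Fin n)) (i : supp x) :
    subvec (supp x) x i ≠ 0 := by
  have := i.2
  simpa [supp, subvec] using this

lemma extZero_subvec_supp (x : EuclideanSpace ℝ (Fin n)) :
    extZero (supp x) (subvec (supp x) x) = x :=
  extZero_subvec fun _ hi => notMem_supp.1 hi

lemma subGrad_eq (hf : ContDiff ℝ 2 f) (hq0 : 0 < q) (x : EuclideanSpace ℝ (Fin n)) :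
    subGrad f A lam q x = subvec (supp x) (redGrad f A lam q x) := by
  rw [subGrad, gradient_subObjective hf hq0 (subvec_supp_ne_zero x), extZero_subvec_supp]

lemma norm_subGrad (hf : ContDiff ℝ 2 f) (hq0 : 0 < q) (x : EuclideanSpace ℝ (Fin n)) :
    ‖subGrad f A lam q x‖ = ‖redGrad f A lam q x‖ := by
  rw [subGrad_eq hf hq0, norm_subvec fun i hi => redGrad_of_eq_zero (notMem_supp.1 hi)]

lemma inner_subGrad (hf : ContDiff ℝ 2 f) (hq0 : 0 < q) {x d : EuclideanSpace ℝ (Fin n)}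
    (hd : ∀ i ∉ supp x, d i = 0) :
    inner ℝ (subGrad f A lam q x) (subvec (supp x) d) = inner ℝ (redGrad f A lam q x) d := by
  rw [subGrad_eq hf hq0, inner_subvec _ hd]

lemma subObjective_line (hq0 : 0 < q) {x d : EuclideanSpace ℝ (Fin n)}
    (hd : ∀ i ∉ supp x, d i = 0) (t : ℝ) :
    subObjective f A lam q (supp x) (subvec (supp x) x + t • subvec (supp x) d) =
      objective f A lam q (x + t • d) := by
  rw [subObjective_eq hq0, map_add, map_smul, extZero_subvec_supp, extZero_subvec hd]

lemma armijo_iff (hf : ContDiff ℝ 2 f) (hq0 : 0 < q) {P : Params}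
    {x d : EuclideanSpace ℝ (Fin n)} (hd : ∀ i ∉ supp x, d i = 0) (j : ℕ) :
    Armijo f A lam q P x d j ↔ objective f A lam q (x + P.β ^ j • d) ≤
      objective f A lam q x + P.ϱ * P.β ^ j * inner ℝ (redGrad f A lam q x) d := by
  have h := subObjective_line (f := f) (A := A) (lam := lam) hq0 hd 0
  rw [zero_smul, zero_smul, add_zero, add_zero] at h
  rw [Armijo, subObjective_line hq0 hd, inner_subGrad hf hq0 hd, h]

lemma subHess_isSymmetric (hf : ContDiff ℝ 2 f) (x : EuclideanSpace ℝ (Fin n)) :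
    (subHess f A lam q x : EuclideanSpace ℝ (supp x) →ₗ[ℝ] EuclideanSpace ℝ (supp x)).IsSymmetric :=
  hess_isSymmetric (contDiffAt_subObjective hf (subvec_supp_ne_zero x))

/-- The Lipschitz constant of the reduced gradient bounds the Hessians of the restrictions. -/
lemma exists_norm_subHess_le (hf : ContDiff ℝ 2 f) (hlam : 0 < lam) (hq0 : 0 < q) (hq1 : q < 1)
    (A : Matrix (Fin m) (Fin n) ℝ) (B : ℝ) {ν : ℝ} (hν : 0 < ν) :
    ∃ M : ℝ, 0 < M ∧ ∀ x : EuclideanSpace ℝ (Fin n), ‖x‖ ≤ B → (∀ i, x i ≠ 0 → ν ≤ |x i|) →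
      ‖subHess f A lam q x‖ ≤ M := by
  obtain ⟨M, hM, hline⟩ := exists_objective_line_le hf hlam hq0 hq1 A B hν
  refine ⟨M, hM, fun x hx hxν => ?_⟩
  set u := subvec (supp x) x with hu
  refine norm_fderiv_le_of_lip' ℝ hM.le ?_
  have hne : ∀ᶠ y in 𝓝 u, ∀ i, y i ≠ 0 := by
    refine eventually_all.2 fun i => ?_
    have : Continuous fun y : EuclideanSpace ℝ (supp x) => y i := by fun_prop
    exact this.continuousAt.eventually_ne (subvec_supp_ne_zero x i)
  filter_upwards [hne, Metric.closedBall_mem_nhds u (half_pos hν)] with y hy hyu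
  rw [gradient_subObjective hf hq0 hy, gradient_subObjective hf hq0 (subvec_supp_ne_zero x)]
  have hxy : extZero (supp x) y = x + (1 : ℝ) • extZero (supp x) (y - u) := by
    rw [map_sub, hu, extZero_subvec_supp, one_smul, add_sub_cancel]
  have hnorm : ‖(1 : ℝ) • extZero (supp x) (y - u)‖ = ‖y - u‖ := by rw [one_smul, norm_extZero]
  have h := (hline x (extZero (supp x) (y - u)) 1 hx hxν
    (fun i hi => extZero_apply_of_notMem _ (notMem_supp.2 hi)) zero_le_one
    (by rw [hnorm, ← dist_eq_norm]; exact hyu)).1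
  rw [← hxy, hnorm] at h
  rw [extZero_subvec_supp]
  exact (norm_subvec_le _ (redGrad f A lam q (extZero (supp x) y) - redGrad f A lam q x)).trans h

lemma exists_norm_redGrad_le (hf : ContDiff ℝ 2 f) (hlam : 0 < lam) (hq0 : 0 < q) (hq1 : q < 1)
    (A : Matrix (Fin m) (Fin n) ℝ) (B : ℝ) {ν : ℝ} (hν : 0 < ν) :
    ∃ R : ℝ, 0 < R ∧ ∀ x : EuclideanSpace ℝ (Fin n), ‖x‖ ≤ B → (∀ i, x i ≠ 0 → ν ≤ |x i|) →
      ‖redGrad f A lam q x‖ ≤ R := by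
  obtain ⟨b, hb⟩ := (isCompact_closedBall (0 : EuclideanSpace ℝ (Fin n))
    B).exists_bound_of_continuousOn (contDiff_smoothPart hf A).gradient.continuous.continuousOn
  refine ⟨√n * (|b| + lam * (q * ν ^ (q - 1))) + 1, by positivity, fun x hx hxν => ?_⟩
  refine (norm_le_mul_of_forall_abs_le (by positivity) fun i => ?_).trans (le_add_of_nonneg_right
    zero_le_one)
  rcases eq_or_ne (x i) 0 with h0 | h0
  · rw [redGrad_of_eq_zero h0, abs_zero]; positivity
  rw [redGrad_of_ne_zero h0]
  refine (abs_add_le _ _).trans (add_le_add ?_ ?_)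
  · exact (PiLp.norm_apply_le _ i).trans ((hb x (by simpa using hx)).trans (le_abs_self b))
  · have hsign : |((SignType.sign (x i) : SignType) : ℝ)| ≤ 1 := by
      rcases lt_trichotomy (x i) 0 with h | h | h <;> simp [h]
    have h2 : |x i| ^ (q - 1) ≤ ν ^ (q - 1) :=
      Real.rpow_le_rpow_of_nonpos hν (hxν i h0) (by linarith)
    rw [abs_mul, abs_of_pos hlam, powDeriv, abs_mul, abs_mul, abs_of_pos hq0,
      abs_of_nonneg (by positivity : 0 ≤ |x i| ^ (q - 1))]
    calc _ ≤ lam * (q * ν ^ (q - 1) * 1) := by gcongr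
      _ = _ := by ring

/-- The regularization makes the operator of the Newton equation uniformly positive definite
relative to a power of the gradient norm, because `b₁ > 1`. -/
lemma norm_newton_direction_le (hf : ContDiff ℝ 2 f) (hq0 : 0 < q) {P : Params}
    {x d : EuclideanSpace ℝ (Fin n)} (hd : ∀ i ∉ supp x, d i = 0)
    (hnewton : regHess f A lam q P x (subvec (supp x) d) = -subGrad f A lam q x) :
    P.b₂ * ‖redGrad f A lam q x‖ ^ P.σ * ‖d‖ ≤ ‖redGrad f A lam q x‖ := by
  rcases eq_or_ne d 0 with rfl | hd0
  · simp
  have h1 := lambdaMin_mul_le (subHess_isSymmetric (A := A) (lam := lam) (q := q) hf x)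
    (subvec (supp x) d)
  have h2 : inner ℝ (regHess f A lam q P x (subvec (supp x) d)) (subvec (supp x) d) ≤
      ‖redGrad f A lam q x‖ * ‖d‖ := by
    rw [hnewton, inner_neg_left, inner_subGrad hf hq0 hd, ← inner_neg_left]
    exact (real_inner_le_norm _ _).trans (by rw [norm_neg])
  rw [regHess, add_apply, inner_add_left, smul_apply,
    inner_smul_left, ContinuousLinearMap.id_apply, real_inner_self_eq_norm_sq, norm_subvec hd,
    norm_subGrad hf hq0, conj_trivial] at h2
  rw [norm_subvec hd] at h1
  have h3 : 0 ≤ lambdaMin (subHess f A lam q x) +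
      P.b₁ * max (-lambdaMin (subHess f A lam q x)) 0 := by
    have h4 := le_max_left (-lambdaMin (subHess f A lam q x)) 0
    have h5 := le_max_right (-lambdaMin (subHess f A lam q x)) 0
    nlinarith [P.one_lt_b₁]
  have h6 := mul_nonneg h3 (sq_nonneg ‖d‖)
  have hdpos : 0 < ‖d‖ := norm_pos_iff.2 hd0
  refine le_of_mul_le_mul_right (a := ‖d‖) ?_ hdpos
  linarith

lemma exists_norm_redGrad_le_newton_direction (hf : ContDiff ℝ 2 f) (hlam : 0 < lam) (hq0 : 0 < q)
    (hq1 : q < 1) (A : Matrix (Fin m) (Fin n) ℝ) (P : Params) (B : ℝ) {ν : ℝ} (hν : 0 < ν) :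
    ∃ κ : ℝ, 0 < κ ∧ ∀ x d : EuclideanSpace ℝ (Fin n), ‖x‖ ≤ B → (∀ i, x i ≠ 0 → ν ≤ |x i|) →
      (∀ i ∉ supp x, d i = 0) →
      regHess f A lam q P x (subvec (supp x) d) = -subGrad f A lam q x →
      ‖redGrad f A lam q x‖ ≤ κ * ‖d‖ := by
  obtain ⟨M, hM, hH⟩ := exists_norm_subHess_le hf hlam hq0 hq1 A B hν
  obtain ⟨R, hR, hr⟩ := exists_norm_redGrad_le hf hlam hq0 hq1 A B hν
  have hb₁ := P.one_lt_b₁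
  have hb₂ := P.b₂_pos
  refine ⟨M + (P.b₁ * M + P.b₂ * R ^ P.σ), by positivity, fun x d hx hxν hd hnewton => ?_⟩
  have h1 := hH x hx hxν
  have h2 := (neg_lambdaMin_le (subHess f A lam q x)).trans h1
  rw [← norm_subGrad hf hq0, ← norm_neg, ← hnewton, regHess, add_apply,
    smul_apply, ContinuousLinearMap.id_apply]
  refine (norm_add_le _ _).trans ?_
  rw [add_mul, ← norm_subvec hd, norm_smul]
  refine add_le_add (((subHess f A lam q x).le_opNorm _).trans (by gcongr)) ?_
  have h3 := le_max_right (-lambdaMin (subHess f A lam q x)) 0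
  rw [norm_subGrad hf hq0, Real.norm_of_nonneg (by positivity)]
  gcongr
  · exact max_le h2 hM.le
  · exact P.σ_pos.le
  · exact hr x hx hxν

end Subspace

/-! ### Estimates for a single Newton step -/

section Newton

variable {m n : ℕ} {f : EuclideanSpace ℝ (Fin m) → ℝ} {A : Matrix (Fin m) (Fin n) ℝ} {lam q : ℝ}

/-- A Newton step `β ^ j • d` decreases the objective by a multiple of `‖r‖` times its length, its
length is at least a multiple of `‖r‖` and at most a multiple of `‖r‖ ^ (1 - σ)`, and the reduced
gradient `r` grows at most linearly along short steps. The lower bound on the length comes from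
the last rejected trial step: either the quadratic upper bound applies to it, or it is longer than
half of the smallest nonzero entry. -/
lemma exists_newton_step_estimates (hf : ContDiff ℝ 2 f) (hlam : 0 < lam) (hq0 : 0 < q)
    (hq1 : q < 1) (A : Matrix (Fin m) (Fin n) ℝ) (P : Params) (B : ℝ) {ν c : ℝ} (hν : 0 < ν)
    (hc : 0 < c) :
    ∃ a M : ℝ, 0 < a ∧ 0 < M ∧ ∀ (x d : EuclideanSpace ℝ (Fin n)) (j : ℕ), ‖x‖ ≤ B →
      (∀ i, x i ≠ 0 → ν ≤ |x i|) → (∀ i ∉ supp x, d i = 0) →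
      regHess f A lam q P x (subvec (supp x) d) = -subGrad f A lam q x →
      IsLeast {j : ℕ | Armijo f A lam q P x d j} j →
      0 < ‖redGrad f A lam q x‖ * ‖d‖ →
      c * (‖redGrad f A lam q x‖ * ‖d‖) ≤ -inner ℝ (redGrad f A lam q x) d →
      a * (‖redGrad f A lam q x‖ * ‖P.β ^ j • d‖) ≤
          objective f A lam q x - objective f A lam q (x + P.β ^ j • d) ∧
        a * ‖redGrad f A lam q x‖ ≤ ‖P.β ^ j • d‖ ∧
        P.b₂ * ‖P.β ^ j • d‖ ≤ ‖redGrad f A lam q x‖ ^ (1 - P.σ) ∧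
        (‖P.β ^ j • d‖ ≤ ν / 2 → ‖redGrad f A lam q (x + P.β ^ j • d)‖ ≤
          ‖redGrad f A lam q x‖ + M * ‖P.β ^ j • d‖) := by
  obtain ⟨κ, hκ, hκ'⟩ := exists_norm_redGrad_le_newton_direction hf hlam hq0 hq1 A P B hν
  obtain ⟨M, hM, hline⟩ := exists_objective_line_le hf hlam hq0 hq1 A B hν
  obtain ⟨R, hR, hR'⟩ := exists_norm_redGrad_le hf hlam hq0 hq1 A B hν
  have hϱ := P.ϱ_pos
  have hϱ' := P.ϱ_lt
  have hβ := P.β_pos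
  have hβ1 := P.β_lt
  have hb₂ := P.b₂_pos
  -- the bounds for `a` come from the Armijo decrease, an accepted full step, a short rejected trial
  -- step and a long rejected trial step, in this order
  refine ⟨min (min (P.ϱ * c) κ⁻¹) (min (P.β * c / (2 * M)) (P.β * ν / (2 * R))), M, by positivity,
    hM, fun x d j hx hxν hd hnewton hls hpos hcurve => ?_⟩
  set a := min (min (P.ϱ * c) κ⁻¹) (min (P.β * c / (2 * M)) (P.β * ν / (2 * R)))
  have ha1 : a ≤ P.ϱ * c := (min_le_left _ _).trans (min_le_left _ _)
  have ha2 : a ≤ κ⁻¹ := (min_le_left _ _).trans (min_le_right _ _)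
  have ha3 : a ≤ P.β * c / (2 * M) := (min_le_right _ _).trans (min_le_left _ _)
  have ha4 : a ≤ P.β * ν / (2 * R) := (min_le_right _ _).trans (min_le_right _ _)
  have hd' : ∀ i, x i = 0 → d i = 0 := fun i hi => hd i (notMem_supp.2 hi)
  have hnorm : ∀ j : ℕ, ‖P.β ^ j • d‖ = P.β ^ j * ‖d‖ := fun j => by
    rw [norm_smul, Real.norm_of_nonneg (by positivity)]
  have hdir := norm_newton_direction_le hf hq0 hd hnewton
  have hκd := hκ' x d hx hxν hd hnewton
  have hRx := hR' x hx hxν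
  set r := redGrad f A lam q x with hr
  have hrpos : 0 < ‖r‖ := pos_of_mul_pos_left hpos (norm_nonneg d)
  have hdpos : 0 < ‖d‖ := pos_of_mul_pos_right hpos (norm_nonneg r)
  refine ⟨?_, ?_, ?_, fun hshort => ?_⟩
  · have h1 := (armijo_iff hf hq0 hd j).1 hls.1
    rw [hnorm]
    have h2 : a * (‖r‖ * (P.β ^ j * ‖d‖)) ≤ P.ϱ * c * (‖r‖ * (P.β ^ j * ‖d‖)) := by gcongr
    have h3 := mul_le_mul_of_nonneg_left hcurve (show 0 ≤ P.ϱ * P.β ^ j by positivity)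
    rw [← hr] at h1
    linarith
  · rw [hnorm]
    rcases j with _ | j
    · rw [pow_zero, one_mul]
      calc a * ‖r‖ ≤ κ⁻¹ * (κ * ‖d‖) := by gcongr
        _ = ‖d‖ := by field_simp
    have hrej : ¬ Armijo f A lam q P x d j := fun h => by
      have := hls.2 h
      omega
    rw [armijo_iff hf hq0 hd, not_le, ← hr] at hrej
    rw [pow_succ' P.β j]
    rcases le_or_gt ‖P.β ^ j • d‖ (ν / 2) with hle | hgt
    · have h1 := (hline x d (P.β ^ j) hx hxν hd' (by positivity) hle).2
      rw [← hr] at h1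
      have ht : 0 < P.β ^ j := by positivity
      generalize P.β ^ j = t at *
      have h2 : t * ((1 - P.ϱ) * -inner ℝ r d) ≤ t * (M * t * ‖d‖ ^ 2) := by linarith
      have h3 := le_of_mul_le_mul_left h2 ht
      have h4 : 1 / 2 * (c * (‖r‖ * ‖d‖)) ≤ (1 - P.ϱ) * -inner ℝ r d := by
        have : 0 ≤ c * (‖r‖ * ‖d‖) := by positivity
        have h7 : 1 / 2 ≤ 1 - P.ϱ := by linarith
        gcongr
      have h5 : (1 / 2 * (c * ‖r‖)) * ‖d‖ ≤ (M * t * ‖d‖) * ‖d‖ := by linarith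
      have h6 := le_of_mul_le_mul_right h5 hdpos
      calc a * ‖r‖ ≤ P.β * c / (2 * M) * ‖r‖ := by gcongr
        _ = P.β / M * (1 / 2 * (c * ‖r‖)) := by field_simp
        _ ≤ P.β / M * (M * t * ‖d‖) := by gcongr
        _ = _ := by field_simp
    · rw [hnorm] at hgt
      calc a * ‖r‖ ≤ P.β * ν / (2 * R) * R := by gcongr
        _ = P.β * (ν / 2) := by field_simp
        _ ≤ P.β * (P.β ^ j * ‖d‖) := by gcongr
        _ = _ := by ring
  · have h1 : P.b₂ * ‖d‖ ≤ ‖r‖ ^ (1 - P.σ) := by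
      rw [Real.rpow_sub hrpos, Real.rpow_one, le_div_iff₀ (by positivity)]
      linarith
    refine le_trans ?_ h1
    rw [hnorm]
    gcongr
    exact mul_le_of_le_one_left hdpos.le (pow_le_one₀ hβ.le hβ1.le)
  · have h1 := (hline x d (P.β ^ j) hx hxν hd' (by positivity) hshort).1
    have h2 := norm_add_le r (redGrad f A lam q (x + P.β ^ j • d) - r)
    rw [add_sub_cancel] at h2
    linarith

end Newton

/-! ### Runs of the algorithm -/

namespace Run

variable {m n : ℕ} {f : EuclideanSpace ℝ (Fin m) → ℝ} {A : Matrix (Fin m) (Fin n) ℝ}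
  {lam q : ℝ} {P : Params}

lemma exists_curve_bound (R : Run f A lam q P) (hf : ContDiff ℝ 2 f) (hq0 : 0 < q)
    (hcurve : R.CurveRatioCondition) :
    ∃ c : ℝ, 0 < c ∧ ∀ᶠ k in atTop, SwitchCond lam q (R.μbar k) (R.x k) (R.xbar k) →
      0 < ‖redGrad f A lam q (R.x k)‖ * ‖R.d k‖ ∧
      c * (‖redGrad f A lam q (R.x k)‖ * ‖R.d k‖) ≤
        -inner ℝ (redGrad f A lam q (R.x k)) (R.d k) := by
  obtain ⟨c, hc0, hc⟩ := EReal.lt_iff_exists_real_btwn.1 hcurve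
  have hc0' : 0 < c := by exact_mod_cast hc0
  refine ⟨c, hc0', ?_⟩
  have h := eventually_lt_of_lt_liminf hc
  rw [eventually_inf_principal] at h
  filter_upwards [h] with k hk hs
  have hoff := R.newton_off k hs
  have h1 : c < R.curveRatio k := by exact_mod_cast hk hs
  rw [curveRatio, inner_subGrad hf hq0 hoff, norm_subGrad hf hq0, norm_subvec hoff] at h1
  -- the ratio is positive, so that its denominator does not vanish
  have hpos : 0 < ‖redGrad f A lam q (R.x k)‖ * ‖R.d k‖ := by
    refine lt_of_le_of_ne (by positivity) fun h0 => ?_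
    rw [← h0, div_zero] at h1
    linarith
  exact ⟨hpos, ((lt_div_iff₀ hpos).1 h1).le⟩

lemma pg_spec (R : Run f A lam q P) (k : ℕ) :
    R.xbar k ∈ proxGrad f A lam q (R.μbar k) (R.x k) ∧ P.μmin ≤ R.μbar k ∧
      objective f A lam q (R.xbar k) ≤
        objective f A lam q (R.x k) - P.α / 2 * ‖R.xbar k - R.x k‖ ^ 2 :=
  (R.pg_step k).spec (R.μ_mem k)

lemma eventually_objective_succ_lt (R : Run f A lam q P) (hf : ContDiff ℝ 2 f) (hq0 : 0 < q)
    (hcurve : R.CurveRatioCondition) :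
    ∀ᶠ k in atTop, objective f A lam q (R.x (k + 1)) < objective f A lam q (R.x k) := by
  obtain ⟨c, hc, hK⟩ := R.exists_curve_bound hf hq0 hcurve
  filter_upwards [hK] with k hk
  by_cases hs : SwitchCond lam q (R.μbar k) (R.x k) (R.xbar k)
  · obtain ⟨h1, h2⟩ := hk hs
    have h3 := (armijo_iff hf hq0 (R.newton_off k hs) _).1 (R.line_search k hs).1
    rw [← R.next_newton k hs] at h3
    have h4 : P.ϱ * P.β ^ R.ls k * inner ℝ (redGrad f A lam q (R.x k)) (R.d k) < 0 := by
      have := P.ϱ_pos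
      have := P.β_pos
      have := mul_pos hc h1
      exact mul_neg_of_pos_of_neg (by positivity) (by linarith)
    linarith
  · have h1 := (R.pg_spec k).2.2
    have h2 : 0 < ‖R.xbar k - R.x k‖ := norm_pos_iff.2 (sub_ne_zero.2 (R.not_stopped k).symm)
    have h3 : 0 < P.α / 2 * ‖R.xbar k - R.x k‖ ^ 2 := by have := P.α_pos; positivity
    rw [R.next_pg k hs]
    linarith

/-- The uniform bounds that hold from some index on: the iterates and the step-sizes are bounded,
and at Newton steps the nonzero entries are bounded away from zero. -/
lemma exists_uniform_bounds (R : Run f A lam q P) (hf : ContDiff ℝ 2 f)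
    (hbdd : BddBelow (Set.range f)) (hlam : 0 < lam) (hq0 : 0 < q) (hq1 : q < 1)
    (hcurve : R.CurveRatioCondition) :
    ∃ B μmax ν : ℝ, 0 < μmax ∧ 0 < ν ∧ ∀ᶠ k in atTop, ‖R.x k‖ ≤ B ∧ ‖R.xbar k‖ ≤ B ∧
      R.μbar k ≤ μmax ∧ (∀ i, R.xbar k i ≠ 0 → ν ≤ |R.xbar k i|) ∧
      (SwitchCond lam q (R.μbar k) (R.x k) (R.xbar k) → ∀ i, R.x k i ≠ 0 → ν ≤ |R.x k i|) := by
  obtain ⟨K, hK⟩ := eventually_atTop.1 (R.eventually_objective_succ_lt hf hq0 hcurve)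
  obtain ⟨B, hB⟩ := exists_norm_le_of_objective_le (A := A) hbdd hlam hq0
    (objective f A lam q (R.x K))
  obtain ⟨μmax, hμmax, hμ⟩ := exists_stepsize_le hf hlam hq0 A P B
  have hC : 0 < lam * q * (1 - q) := by have := sub_pos.2 hq1; positivity
  refine ⟨B, μmax, (lam * q * (1 - q) / μmax) ^ (1 / (2 - q)), hμmax, by positivity, ?_⟩
  filter_upwards [eventually_ge_atTop K] with k hk
  have hanti : objective f A lam q (R.x k) ≤ objective f A lam q (R.x K) := by
    induction k, hk using Nat.le_induction with
    | base => exact le_rfl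
    | succ k hk ih => exact (hK k hk).le.trans ih
  obtain ⟨hmem, hlow, hdec⟩ := R.pg_spec k
  have hμ0 : 0 < R.μbar k := P.μmin_pos.trans_le hlow
  have hμk := hμ _ _ _ _ (hB _ hanti) (R.μ_mem k) (R.pg_step k)
  refine ⟨hB _ hanti, hB _ ?_, hμk, fun i hi => ?_, fun hs i hi => ?_⟩
  · have : 0 ≤ P.α / 2 * ‖R.xbar k - R.x k‖ ^ 2 := by have := P.α_pos; positivity
    linarith
  · exact rpow_le_of_mul_rpow_le hC hμmax (abs_pos.2 hi) hq1
      ((proxGrad_lower_bound hlam hq0 hq1 hμ0 hmem hi).trans hμk)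
  · exact rpow_le_of_mul_rpow_le hC hμmax (abs_pos.2 hi) hq1
      ((hs.lower_bound hlam hq0 hq1 hμ0 hmem hi).trans hμk)

lemma tendsto_objective_sub (R : Run f A lam q P) (hf : ContDiff ℝ 2 f)
    (hbdd : BddBelow (Set.range f)) (hlam : 0 < lam) (hq0 : 0 < q)
    (hcurve : R.CurveRatioCondition) :
    Tendsto (fun k => objective f A lam q (R.x k) - objective f A lam q (R.x (k + 1))) atTop
      (𝓝 0) := by
  obtain ⟨K, hK⟩ := eventually_atTop.1 (R.eventually_objective_succ_lt hf hq0 hcurve)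
  have hanti : Antitone fun k => objective f A lam q (R.x (k + K)) :=
    antitone_nat_of_succ_le fun k => by
      rw [show k + 1 + K = k + K + 1 by omega]
      exact (hK (k + K) (by omega)).le
  have hb : BddBelow (Set.range fun k => objective f A lam q (R.x (k + K))) := by
    obtain ⟨b, hb⟩ := hbdd
    refine ⟨b, ?_⟩
    rintro _ ⟨k, rfl⟩
    have h1 : b ≤ smoothPart f A (R.x (k + K)) := hb ⟨_, rfl⟩
    have h2 := mul_nonneg hlam.le (lqPow_nonneg q (R.x (k + K)))
    simp only [objective]
    linarith
  have hlim := (tendsto_add_atTop_iff_nat (f := fun k => objective f A lam q (R.x k)) K).1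
    (tendsto_atTop_ciInf hanti hb)
  simpa using hlim.sub ((tendsto_add_atTop_iff_nat 1).2 hlim)

/-- The iterates form a descent sequence whose steps tend to zero. -/
lemma exists_isDescentSequence (R : Run f A lam q P) (hf : ContDiff ℝ 2 f)
    (hbdd : BddBelow (Set.range f)) (hlam : 0 < lam) (hq0 : 0 < q) (hq1 : q < 1)
    (hcurve : R.CurveRatioCondition) :
    Tendsto (fun k => ‖R.x (k + 1) - R.x k‖) atTop (𝓝 0) ∧
      ∃ (K : ℕ) (c C : ℝ),
        IsDescentSequence (objective f A lam q) (redGrad f A lam q) R.x K c C := by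
  obtain ⟨B, μmax, ν, hμmax, hν, hbounds⟩ := R.exists_uniform_bounds hf hbdd hlam hq0 hq1 hcurve
  obtain ⟨c, hc, hcurv⟩ := R.exists_curve_bound hf hq0 hcurve
  obtain ⟨a, M, ha, hM, hnewt⟩ := exists_newton_step_estimates hf hlam hq0 hq1 A P B hν hc
  obtain ⟨L, hL, hlip⟩ := exists_gradient_lipschitz_of_norm_le (contDiff_smoothPart hf A) B
  have hα := P.α_pos
  have hb₂ := P.b₂_pos
  have hσ : 0 < 1 - P.σ := by linarith [P.σ_le]
  set F := objective f A lam q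
  set r := redGrad f A lam q
  have hN : ∀ᶠ k in atTop, SwitchCond lam q (R.μbar k) (R.x k) (R.xbar k) →
      a * (‖r (R.x k)‖ * ‖R.x (k + 1) - R.x k‖) ≤ F (R.x k) - F (R.x (k + 1)) ∧
      a * ‖r (R.x k)‖ ≤ ‖R.x (k + 1) - R.x k‖ ∧
      P.b₂ * ‖R.x (k + 1) - R.x k‖ ≤ ‖r (R.x k)‖ ^ (1 - P.σ) ∧
      (‖R.x (k + 1) - R.x k‖ ≤ ν / 2 →
        ‖r (R.x (k + 1))‖ ≤ ‖r (R.x k)‖ + M * ‖R.x (k + 1) - R.x k‖) := by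
    filter_upwards [hbounds, hcurv] with k hb hk hs
    have h := hnewt (R.x k) (R.d k) (R.ls k) hb.1 (hb.2.2.2.2 hs) (R.newton_off k hs)
      (R.newton_eq k hs) (R.line_search k hs) (hk hs).1 (hk hs).2
    have h1 : R.x (k + 1) - R.x k = P.β ^ R.ls k • R.d k := by rw [R.next_newton k hs]; simp
    rw [← R.next_newton k hs, ← h1] at h
    exact h
  have hPG : ∀ k, ¬ SwitchCond lam q (R.μbar k) (R.x k) (R.xbar k) →
      P.α / 2 * ‖R.x (k + 1) - R.x k‖ ^ 2 ≤ F (R.x k) - F (R.x (k + 1)) := by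
    intro k hs
    have h := (R.pg_spec k).2.2
    rw [R.next_pg k hs]
    linarith
  have hstep : Tendsto (fun k => ‖R.x (k + 1) - R.x k‖) atTop (𝓝 0) := by
    set δ : ℕ → ℝ := fun k => F (R.x k) - F (R.x (k + 1))
    have hδ : Tendsto δ atTop (𝓝 0) := R.tendsto_objective_sub hf hbdd hlam hq0 hcurve
    have hup : Tendsto (fun k => √(2 / P.α * δ k) + (√(δ k) / a) ^ (1 - P.σ) / P.b₂) atTop
        (𝓝 0) := by
      have hcont : Continuous fun s : ℝ =>
          √(2 / P.α * s) + (√s / a) ^ (1 - P.σ) / P.b₂ := by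
        refine Continuous.add (by fun_prop) (Continuous.div_const ?_ _)
        exact (by fun_prop : Continuous fun s : ℝ => √s / a).rpow_const fun _ => Or.inr hσ.le
      have h := (hcont.tendsto 0).comp hδ
      simpa [Real.zero_rpow hσ.ne', Function.comp_def] using h
    refine squeeze_zero' (Eventually.of_forall fun _ => norm_nonneg _) ?_ hup
    filter_upwards [hN] with k hk
    by_cases hs : SwitchCond lam q (R.μbar k) (R.x k) (R.xbar k)
    · obtain ⟨h1, h2, h3, -⟩ := hk hs
      refine le_add_of_nonneg_of_le (Real.sqrt_nonneg _) ?_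
      have h4 : ‖r (R.x k)‖ ≤ √(δ k) / a := by
        rw [le_div_iff₀ ha]
        refine Real.le_sqrt_of_sq_le ?_
        have h5 := mul_le_mul_of_nonneg_left h2 (mul_nonneg ha.le (norm_nonneg (r (R.x k))))
        calc _ = a * ‖r (R.x k)‖ * (a * ‖r (R.x k)‖) := by ring
          _ ≤ _ := h5
          _ = a * (‖r (R.x k)‖ * ‖R.x (k + 1) - R.x k‖) := by ring
          _ ≤ δ k := h1
      rw [le_div_iff₀ hb₂, mul_comm]
      exact h3.trans (Real.rpow_le_rpow (norm_nonneg _) h4 hσ.le)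
    · refine le_add_of_le_of_nonneg ?_ (by positivity)
      refine Real.le_sqrt_of_sq_le ?_
      have h1 := mul_le_mul_of_nonneg_left (hPG k hs) (show 0 ≤ 2 / P.α by positivity)
      calc _ = 2 / P.α * (P.α / 2 * ‖R.x (k + 1) - R.x k‖ ^ 2) := by field_simp
        _ ≤ _ := h1
  refine ⟨hstep, ?_⟩
  obtain ⟨K, hK⟩ := eventually_atTop.1 ((R.eventually_objective_succ_lt hf hq0 hcurve).and
    (hN.and (hbounds.and (hstep.eventually (ge_mem_nhds (half_pos hν))))))
  refine ⟨K, min (P.α / 2) a, L + μmax + (1 / a + M), by positivity, by positivity,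
    fun k hk => (hK k hk).1, fun k hk => ?_, fun k hk => ?_⟩
  · by_cases hs : SwitchCond lam q (R.μbar k) (R.x k) (R.xbar k)
    · refine Or.inr (le_trans ?_ ((hK k hk).2.1 hs).1)
      gcongr
      exact min_le_right _ _
    · refine Or.inl (le_trans ?_ (hPG k hs))
      gcongr
      exact min_le_left _ _
  · obtain ⟨-, hNk, hbk, hshort⟩ := hK k hk
    have hΔ := norm_nonneg (R.x (k + 1) - R.x k)
    by_cases hs : SwitchCond lam q (R.μbar k) (R.x k) (R.xbar k)
    · obtain ⟨-, h2, -, h4⟩ := hNk hs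
      have h5 : ‖r (R.x k)‖ ≤ 1 / a * ‖R.x (k + 1) - R.x k‖ := by
        rw [one_div_mul_eq_div, le_div_iff₀ ha]; linarith
      have h6 : 0 ≤ (L + μmax) * ‖R.x (k + 1) - R.x k‖ := by positivity
      linarith [h4 hshort]
    · have hmem := (R.pg_spec k).1
      have hμ0 : 0 < R.μbar k := P.μmin_pos.trans_le (R.pg_spec k).2.1
      have h1 := norm_redGrad_proxGrad_le hμ0 hmem
      have h2 := hlip _ _ hbk.2.1 hbk.1
      rw [← R.next_pg k hs] at h1 h2
      have h3 : R.μbar k * ‖R.x (k + 1) - R.x k‖ ≤ μmax * ‖R.x (k + 1) - R.x k‖ := by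
        gcongr
        exact hbk.2.2.1
      have h6 : 0 ≤ (1 / a + M) * ‖R.x (k + 1) - R.x k‖ := by positivity
      linarith

lemma exists_mapClusterPt (R : Run f A lam q P) (hf : ContDiff ℝ 2 f)
    (hbdd : BddBelow (Set.range f)) (hlam : 0 < lam) (hq0 : 0 < q) (hq1 : q < 1)
    (hcurve : R.CurveRatioCondition) : ∃ x₀, MapClusterPt x₀ atTop R.x := by
  obtain ⟨B, _, _, _, _, hbounds⟩ := R.exists_uniform_bounds hf hbdd hlam hq0 hq1 hcurve
  obtain ⟨x₀, -, h⟩ := (isCompact_closedBall (0 : EuclideanSpace ℝ (Fin n))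
    B).exists_mapClusterPt_of_frequently (l := atTop) (f := R.x)
    (hbounds.mono fun k hk => by simpa using hk.1).frequently
  exact ⟨x₀, h⟩

end Run

/-! ### Stationarity of the limit -/

lemma continuousAt_powDeriv (q : ℝ) {t : ℝ} (ht : t ≠ 0) : ContinuousAt (powDeriv q) t := by
  have h1 : ContinuousAt (fun s : ℝ => |s| ^ (q - 1)) t :=
    continuous_abs.continuousAt.rpow_const (Or.inl (abs_ne_zero.2 ht))
  have h2 : ContinuousAt (fun s : ℝ => ((SignType.sign s : SignType) : ℝ)) t := by
    have : Continuous fun s : SignType => (s : ℝ) := continuous_of_discreteTopology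
    exact this.continuousAt.comp (continuousAt_sign_of_ne_zero ht)
  exact (continuousAt_const.mul h1).mul h2

lemma sign_eq_of_tendsto {u v : ℕ → ℝ} {a b ν : ℝ} (hν : 0 < ν) (hu : Tendsto u atTop (𝓝 a))
    (hv : Tendsto v atTop (𝓝 b))
    (hs : ∀ᶠ k in atTop, SignType.sign (u k) = SignType.sign (v k) ∧ (v k ≠ 0 → ν ≤ |v k|))
    (ha : a ≠ 0) : SignType.sign a = SignType.sign b := by
  rcases ha.lt_or_gt with ha | ha
  · have hb : b ≤ -ν := by
      refine le_of_tendsto hv ?_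
      filter_upwards [hs, hu.eventually (gt_mem_nhds ha)] with k hk hk'
      have h1 : v k < 0 := by rw [← sign_eq_neg_one_iff, ← hk.1, sign_neg hk']
      have := hk.2 h1.ne
      rw [abs_of_neg h1] at this
      linarith
    rw [sign_neg ha, sign_neg (by linarith)]
  · have hb : ν ≤ b := by
      refine ge_of_tendsto hv ?_
      filter_upwards [hs, hu.eventually (lt_mem_nhds ha)] with k hk hk'
      have h1 : 0 < v k := by rw [← sign_eq_one_iff, ← hk.1, sign_pos hk']
      have := hk.2 h1.ne'
      rwa [abs_of_pos h1] at this
    rw [sign_pos ha, sign_pos (by linarith)]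

section Stationary

variable {m n : ℕ} {f : EuclideanSpace ℝ (Fin m) → ℝ} {A : Matrix (Fin m) (Fin n) ℝ} {lam q : ℝ}

/-- If the switching condition holds along sequences of iterates, proximal gradient points and
step-sizes, and the reduced gradients tend to zero, then the limits of the iterates and of the
proximal gradient points agree: on the support both are critical points, with nonnegative second
derivative, of the same one-dimensional function. -/
lemma eq_of_switchCond_limit (hf : ContDiff ℝ 2 f) (hlam : 0 < lam) (hq0 : 0 < q) (hq1 : q < 1)
    {x z : ℕ → EuclideanSpace ℝ (Fin n)} {μ : ℕ → ℝ} {x₀ z₀ : EuclideanSpace ℝ (Fin n)}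
    {μ₀ ν : ℝ} (hν : 0 < ν) (hx : Tendsto x atTop (𝓝 x₀)) (hz : Tendsto z atTop (𝓝 z₀))
    (hμ : Tendsto μ atTop (𝓝 μ₀)) (hμ₀ : 0 < μ₀) (hmem₀ : z₀ ∈ proxGrad f A lam q μ₀ x₀)
    (hr : Tendsto (fun k => redGrad f A lam q (x k)) atTop (𝓝 0))
    (hev : ∀ᶠ k in atTop, 0 < μ k ∧ z k ∈ proxGrad f A lam q (μ k) (x k) ∧
      SwitchCond lam q (μ k) (x k) (z k) ∧ (∀ i, x k i ≠ 0 → ν ≤ |x k i|) ∧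
      (∀ i, z k i ≠ 0 → ν ≤ |z k i|)) : x₀ = z₀ := by
  ext i
  have hcoord : Continuous fun y : EuclideanSpace ℝ (Fin n) => y i := by fun_prop
  have hxi : Tendsto (fun k => x k i) atTop (𝓝 (x₀ i)) := (hcoord.tendsto x₀).comp hx
  have hzi : Tendsto (fun k => z k i) atTop (𝓝 (z₀ i)) := (hcoord.tendsto z₀).comp hz
  rcases eq_or_ne (x₀ i) 0 with h0 | h0
  · have hz0 : ∀ᶠ k in atTop, z k i = 0 := by
      filter_upwards [hev, (h0 ▸ hxi).abs.eventually (gt_mem_nhds (by simpa using hν))]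
        with k hk hk'
      rw [← sign_eq_zero_congr hk.2.2.1.1 i]
      by_contra hne
      exact absurd (hk.2.2.2.1 i hne) (not_le.2 hk')
    rw [h0]
    exact tendsto_nhds_unique (tendsto_const_nhds.congr' (hz0.mono fun k hk => hk.symm)) hzi
  have hsign : SignType.sign (x₀ i) = SignType.sign (z₀ i) :=
    sign_eq_of_tendsto hν hxi hzi (hev.mono fun k hk => ⟨hk.2.2.1.1 i, hk.2.2.2.2 i⟩) h0
  have hz0 : z₀ i ≠ 0 := by
    rw [← sign_ne_zero, ← hsign, sign_ne_zero]; exact h0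
  have hne : ∀ᶠ k in atTop, x k i ≠ 0 := hxi.eventually_ne h0
  have hx2 : lam * q * (1 - q) * |x₀ i| ^ (q - 2) ≤ μ₀ := by
    refine le_of_tendsto_of_tendsto
      ((hxi.abs.rpow_const (Or.inl (abs_ne_zero.2 h0))).const_mul _) hμ ?_
    filter_upwards [hev, hne] with k hk hk'
    exact hk.2.2.1.lower_bound hlam hq0 hq1 hk.1 hk.2.1 hk'
  have hcrit : gradient (smoothPart f A) x₀ i + lam * powDeriv q (x₀ i) = 0 := by
    have hg : Tendsto (fun k => gradient (smoothPart f A) (x k) i) atTop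
        (𝓝 (gradient (smoothPart f A) x₀ i)) :=
      ((hcoord.comp (contDiff_smoothPart hf A).gradient.continuous).tendsto x₀).comp hx
    have h1 := hg.add (((continuousAt_powDeriv q h0).tendsto.comp hxi).const_mul lam)
    have h2 : Tendsto (fun k => redGrad f A lam q (x k) i) atTop (𝓝 0) := by
      simpa [Function.comp_def] using (hcoord.tendsto 0).comp hr
    refine tendsto_nhds_unique (h1.congr' ?_) h2
    filter_upwards [hne] with k hk
    exact (redGrad_of_ne_zero hk).symm
  have hfirst := proxGrad_first_order hμ₀ hmem₀ hz0
  exact eq_of_critical hlam hq0 hq1 hsign h0 hx2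
    (proxGrad_lower_bound hlam hq0 hq1 hμ₀ hmem₀ hz0) (by linarith)

end Stationary

namespace Run

variable {m n : ℕ} {f : EuclideanSpace ℝ (Fin m) → ℝ} {A : Matrix (Fin m) (Fin n) ℝ}
  {lam q : ℝ} {P : Params}

lemma isLStationary_of_tendsto (R : Run f A lam q P) (hf : ContDiff ℝ 2 f)
    (hbdd : BddBelow (Set.range f)) (hlam : 0 < lam) (hq0 : 0 < q) (hq1 : q < 1)
    (hcurve : R.CurveRatioCondition) {x₀ : EuclideanSpace ℝ (Fin n)}
    (hx₀ : Tendsto R.x atTop (𝓝 x₀)) : IsLStationary f A lam q x₀ := by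
  obtain ⟨B, μmax, ν, hμmax, hν, hbounds⟩ := R.exists_uniform_bounds hf hbdd hlam hq0 hq1 hcurve
  have hcomp : IsCompact (Metric.closedBall (0 : EuclideanSpace ℝ (Fin n)) B ×ˢ
      Set.Icc P.μmin μmax) := (isCompact_closedBall _ _).prod isCompact_Icc
  -- every subsequence has a further one along which the proximal gradient steps converge
  have hsub : ∀ φ : ℕ → ℕ, StrictMono φ → ∃ (θ : ℕ → ℕ) (z₀ : EuclideanSpace ℝ (Fin n)) (μ₀ : ℝ),
      StrictMono θ ∧ 0 < μ₀ ∧ Tendsto (fun k => R.xbar (φ (θ k))) atTop (𝓝 z₀) ∧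
      Tendsto (fun k => R.μbar (φ (θ k))) atTop (𝓝 μ₀) ∧ z₀ ∈ proxGrad f A lam q μ₀ x₀ := by
    intro φ hφ
    have hmem : ∀ᶠ k in atTop, (R.xbar (φ k), R.μbar (φ k)) ∈
        Metric.closedBall (0 : EuclideanSpace ℝ (Fin n)) B ×ˢ Set.Icc P.μmin μmax := by
      filter_upwards [hφ.tendsto_atTop.eventually hbounds] with k hk
      exact ⟨by simpa using hk.2.1, (R.pg_spec _).2.1, hk.2.2.1⟩
    obtain ⟨⟨z₀, μ₀⟩, ha, θ, hθ, hlim⟩ := hcomp.tendsto_subseq' hmem.frequently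
    have hμ₀ : 0 < μ₀ := P.μmin_pos.trans_le ha.2.1
    have h1 := (continuous_fst.tendsto _).comp hlim
    have h2 := (continuous_snd.tendsto _).comp hlim
    exact ⟨θ, z₀, μ₀, hθ, hμ₀, h1, h2,
      proxGrad_closed hf hq0 (hx₀.comp (hφ.comp hθ).tendsto_atTop) h1 h2 hμ₀
        fun k => (R.pg_spec _).1⟩
  by_cases hcase : ∃ᶠ k in atTop, ¬ SwitchCond lam q (R.μbar k) (R.x k) (R.xbar k)
  · obtain ⟨φ, hφ, hφs⟩ := extraction_of_frequently_atTop hcase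
    obtain ⟨θ, z₀, μ₀, hθ, hμ₀, h1, -, hmem⟩ := hsub φ hφ
    have h2 : Tendsto (fun k => R.xbar (φ (θ k))) atTop (𝓝 x₀) := by
      have := hx₀.comp ((tendsto_add_atTop_nat 1).comp (hφ.comp hθ).tendsto_atTop)
      exact this.congr fun k => R.next_pg _ (hφs (θ k))
    rw [tendsto_nhds_unique h1 h2] at hmem
    exact ⟨μ₀, hμ₀, hmem⟩
  · rw [not_frequently] at hcase
    obtain ⟨θ, z₀, μ₀, hθ, hμ₀, h1, h2, hmem⟩ := hsub id strictMono_id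
    obtain ⟨hstep, K, c, C, H⟩ := R.exists_isDescentSequence hf hbdd hlam hq0 hq1 hcurve
    have hr : Tendsto (fun k => redGrad f A lam q (R.x k)) atTop (𝓝 0) := by
      rw [← tendsto_add_atTop_iff_nat 1]
      refine squeeze_zero_norm' ?_ (by simpa using hstep.const_mul C)
      filter_upwards [eventually_ge_atTop K] with k hk using H.subgrad_le k hk
    have hev : ∀ᶠ k in atTop, 0 < R.μbar k ∧
        R.xbar k ∈ proxGrad f A lam q (R.μbar k) (R.x k) ∧
        SwitchCond lam q (R.μbar k) (R.x k) (R.xbar k) ∧ (∀ i, R.x k i ≠ 0 → ν ≤ |R.x k i|) ∧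
        (∀ i, R.xbar k i ≠ 0 → ν ≤ |R.xbar k i|) := by
      filter_upwards [hcase, hbounds] with k hk hb
      rw [not_not] at hk
      exact ⟨P.μmin_pos.trans_le (R.pg_spec k).2.1, (R.pg_spec k).1, hk, hb.2.2.2.2 hk, hb.2.2.2.1⟩
    have hθ' := hθ.tendsto_atTop
    have heq := eq_of_switchCond_limit hf hlam hq0 hq1 hν (hx₀.comp hθ') h1 h2 hμ₀ hmem
      (hr.comp hθ') (hθ'.eventually hev)
    exact ⟨μ₀, hμ₀, by rwa [← heq] at hmem⟩

end Run

end HpgSRN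

theorem mainTheorem1 {m n : ℕ} (f : EuclideanSpace ℝ (Fin m) → ℝ) (A : Matrix (Fin m) (Fin n) ℝ)
    (lam q : ℝ) (hf : ContDiff ℝ 2 f) (hbdd : BddBelow (Set.range f)) (hlam : 0 < lam)
    (hq0 : 0 < q) (hq1 : q < 1) (P : HpgSRN.Params) (R : HpgSRN.Run f A lam q P)
    (hLip : LocallyLipschitz (fun z => HpgSRN.hess f z)) (hcurve : R.CurveRatioCondition)
    (hKL : HpgSRN.IsKLFunction (HpgSRN.objective f A lam q)) :
    Summable (fun k => ‖R.x (k + 1) - R.x k‖) ∧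
      ∃ xstar : EuclideanSpace ℝ (Fin n),
        Filter.Tendsto R.x Filter.atTop (nhds xstar) ∧
        HpgSRN.IsLStationary f A lam q xstar ∧
        (HpgSRN.HasKLPropertyHalf (HpgSRN.objective f A lam q) xstar →
          HpgSRN.ConvergesRLinearly R.x xstar) := by
  have hr := fun y => HpgSRN.redGrad_mem_limitingSubdiff (f := f) (A := A) hf hlam hq1 hq0 y
  have hcont := HpgSRN.continuous_objective (A := A) (lam := lam) hf hq0
  obtain ⟨hstep, K, c, C, H⟩ := R.exists_isDescentSequence hf hbdd hlam hq0 hq1 hcurve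
  obtain ⟨x₀, hx₀⟩ := R.exists_mapClusterPt hf hbdd hlam hq0 hq1 hcurve
  have hsum := H.summable hcont hr hstep hx₀ (hKL x₀ ⟨_, hr x₀⟩)
  refine ⟨hsum, ?_⟩
  obtain ⟨xstar, hxstar⟩ := cauchySeq_tendsto_of_complete
    (cauchySeq_of_summable_dist (f := R.x) (hsum.congr fun k => by
      rw [dist_comm, dist_eq_norm]))
  exact ⟨xstar, hxstar, R.isLStationary_of_tendsto hf hbdd hlam hq0 hq1 hcurve hxstar,
    fun hhalf => H.convergesRLinearly hcont hr hxstar hhalf⟩
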